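/- **Thermalization of the perturbed free Fermi gas in any dimension.** Let $d\ge 1$, $L,N\in\mathbb{N}$, let $\Lambda=\{1,\dots,L\}^d$ with periodic boundary conditions, and let $\mathcal{H}$ be the $N$-particle sector of fermionic Fock space over $\Lambda$, with annihilation and creation operators $c_x,c_x^\dagger$ ($x\in\Lambda$). On $\mathcal{H}$ let $$H_0^{\mathrm{fF}}=-\sum_{x,y\in\Lambda,\ \mathrm{dist}(x,y)=1}c_x^\dagger c_y ,$$ where $\mathrm{dist}$ is the nearest-neighbour (graph) distance on the periodic lattice. Let $\Gamma\subseteq\Lambda$ be an arbitrary region, $\mu=|\Gamma|/|\Lambda|$, $N_\Gamma=\sum_{x\in\Gamma}c_x^\dagger c_x$, $0<\eta<\frac32\mu(1-\mu)$, and let $$P_{\mathrm{eq},\eta}=\mathbf 1_{[N(\mu-\eta),\,N(\mu+\eta)]}(N_\Gamma),\qquad P_{\mathrm{neq},\eta}=I-P_{\mathrm{eq},\eta}.$$ Let $V$ be a random self-adjoint operator on $\mathcal{H}$ whose distribution $\rho$ is a probability measure that is continuous (absolutely continuous with respect to the Lebesgue measure on the real vector space of self-adjoint operators on $\mathcal{H}$)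 and invariant under $V\mapsto UVU^\dagger$ for every unitary $U$ commuting with $H_0^{\mathrm{fF}}$. For $\lambda\in\mathbb{R}$ put $H=H_0^{\mathrm{fF}}+\lambda V$. Let $\mathcal{H}_\nu\subseteq\mathcal{H}$ be any nonzero subspace, $\mathbb{S}(\mathcal{H}_\nu)$ its unit sphere with the uniform probability distribution, and for $\psi_0\in\mathbb{S}(\mathcal{H}_\nu)$ let $\psi_t=e^{-iHt}\psi_0$. Then for all $\delta,\delta',\delta''>0$ there exists $\lambda_0>0$ such that for all $\lambda\in(0,\lambda_0)$, for $(1-\delta)$-most $V$, $(1-\delta')$-most $\psi_0\in\mathbb{S}(\mathcal{H}_\nu)$ are such that for $(1-\delta'')$-most $t\in[0,\infty)$ $$\|P_{\mathrm{neq},\eta}\psi_t\|^2<\frac{6}{\delta\delta'\delta''}\exp\!\Bigl(-\frac{\eta^2}{3\mu(1-\mu)}N\Bigr).$$ Here "$(1-\delta)$-most $V$" means with $\rho$-probability at least $1-\delta$; "$(1-\delta')$-most $\psi_0$" means a set of uniform measure at least $1-\delta'$; and "$S(t)$ for $(1-\delta'')$-most $t\in[0,\infty)$" means $\liminf_{T\to\infty}\frac1T|\{t\in[0,T]:S(t)\}|\ge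 1-\delta''$, with $|\cdot|$ the Lebesgue measure. -/

import Mathlib

open MeasureTheory Filter Set
open scoped ENNReal Topology

noncomputable section

namespace FermiGas

/-! ### Typicality: `(1 - δ)`-most elements, and `(1 - δ)`-most times -/

/-- `S x` holds for `(1 - δ)`-most `x` with respect to the measure `P`: the set of good `x` has
measure at least `1 - δ`. So as not to depend on the measurability of this set, the bound is
required of a measurable subset of it; for measurable sets this is the same. -/
def ForMost {α : Type*} [MeasurableSpace α] (P : Measure α) (δ : ℝ) (S : α → Prop) : Prop :=
  ∃ A : Set α, MeasurableSet A ∧ A ⊆ {x | S x} ∧ ENNReal.ofReal (1 - δ) ≤ P A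

/-- `S t` holds for `(1 - δ)`-most `t ∈ [0, ∞)`:
`liminf_{T → ∞} (1 / T) |{t ∈ [0, T] : S t}| ≥ 1 - δ`, with `|·|` the Lebesgue measure. -/
def ForMostTimes (δ : ℝ) (S : ℝ → Prop) : Prop :=
  ENNReal.ofReal (1 - δ) ≤
    liminf (fun T : ℝ => volume {t : ℝ | t ∈ Icc 0 T ∧ S t} / ENNReal.ofReal T) atTop

/-! ### Finite-dimensional quantum mechanics -/

section General

variable {E : Type*} [NormedAddCommGroup E] [InnerProductSpace ℂ E] [FiniteDimensional ℂ E]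

/-- The uniform probability distribution on the unit sphere of a (nonzero) subspace `K`: the
normalized surface measure induced by the Lebesgue measure of `K`. -/
def uniformSphere [MeasurableSpace E] [BorelSpace E] (K : Submodule ℂ E) :
    Measure (Metric.sphere (0 : K) 1) :=
  ((Measure.addHaar : Measure K).toSphere univ)⁻¹ • (Measure.addHaar : Measure K).toSphere

/-- The spectral projection `1_I(A)` of a self-adjoint operator `A`: the orthogonal projection
onto the span of the eigenspaces of `A` with eigenvalue in `I`. -/
def spectralProj (A : E →L[ℂ] E) (I : Set ℝ) : E →L[ℂ] E :=
  (⨆ r ∈ I, Module.End.eigenspace (A : E →ₗ[ℂ] E) (r : ℂ)).starProjection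

variable [CompleteSpace E]

/-- `ψ_t = exp(-i H t) ψ₀`. -/
def evolve (H : E →L[ℂ] E) (t : ℝ) (ψ₀ : E) : E :=
  NormedSpace.exp ((-(Complex.I * (t : ℂ))) • H) ψ₀

/-- Conjugation `V ↦ U V U†` of self-adjoint operators. -/
def conjBy (U : E →L[ℂ] E) (V : selfAdjoint (E →L[ℂ] E)) : selfAdjoint (E →L[ℂ] E) :=
  ⟨U * V * star U, V.2.conjugate U⟩

instance locallyCompactSpace_selfAdjoint : LocallyCompactSpace (selfAdjoint (E →L[ℂ] E)) := by
  have : ProperSpace (E →L[ℂ] E) := FiniteDimensional.proper_rclike ℂ _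
  have hc : IsClosed ((selfAdjoint (E →L[ℂ] E) : Set (E →L[ℂ] E))) :=
    isClosed_eq continuous_star continuous_id
  exact hc.isClosedEmbedding_subtypeVal.locallyCompactSpace

/-- A continuous distribution on the real vector space of self-adjoint operators: it is absolutely
continuous with respect to the Lebesgue (i.e. additive Haar) measure of this space. -/
def IsContinuousLaw (ρ : Measure (selfAdjoint (E →L[ℂ] E))) : Prop :=
  ρ ≪ (Measure.addHaar : Measure (selfAdjoint (E →L[ℂ] E)))

/-- The distribution is invariant under conjugation with all unitaries commuting with `H₀`. -/
def IsInvariantLaw (H₀ : E →L[ℂ] E) (ρ : Measure (selfAdjoint (E →L[ℂ] E))) : Prop :=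
  ∀ U ∈ unitary (E →L[ℂ] E), Commute U H₀ → ρ.map (conjBy U) = ρ

end General

/-! ### The free Fermi gas on the discrete torus -/

variable {d L : ℕ}

/-- The lattice with `L ^ d` sites, coordinates being taken modulo `L`. -/
abbrev Site (d L : ℕ) : Type := Fin d → Fin L

/-- Distance on the lattice with periodic boundary conditions (subtraction in `Fin L` is
modulo `L`). -/
def torusDist (x y : Site d L) : ℕ :=
  ∑ i, min (x i - y i).val (y i - x i).val

/-- Fermionic Fock space over the lattice in the occupation number representation: the basis
vector of `S` is the state in which exactly the sites in `S` are occupied. -/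
abbrev Fock (d L : ℕ) : Type := EuclideanSpace ℂ (Finset (Site d L))

/-- The fermionic sign, for the lexicographic ordering of the sites. -/
def fermiSign (x : Site d L) (S : Finset (Site d L)) : ℂ :=
  (-1) ^ {y : Site d L | y ∈ S ∧ toLex y < toLex x}.ncard

/-- The annihilation operator `c_x`. It sends the basis vector of a set containing `x` to
`±` that of the set with `x` removed, and all other basis vectors to zero. -/
def annihilate (x : Site d L) : Fock d L →L[ℂ] Fock d L :=
  LinearMap.toContinuousLinearMap
    { toFun := fun ψ => WithLp.toLp 2 fun S =>
        if x ∈ S then 0 else fermiSign x S * ψ (insert x S)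
      map_add' := fun ψ φ => by
        ext S
        by_cases h : x ∈ S <;> simp [h, mul_add]
      map_smul' := fun a ψ => by
        ext S
        by_cases h : x ∈ S <;> simp [h, mul_left_comm] }

/-- The creation operator `c_x†`. -/
def create (x : Site d L) : Fock d L →L[ℂ] Fock d L :=
  ContinuousLinearMap.adjoint (annihilate x)

/-- `H₀ = - ∑_{dist(x, y) = 1} c_x† c_y` on Fock space. -/
def fockHamiltonian (d L : ℕ) : Fock d L →L[ℂ] Fock d L :=
  -∑ x : Site d L, ∑ y : Site d L with torusDist x y = 1, create x ∘L annihilate y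

/-- `N_Γ = ∑_{x ∈ Γ} c_x† c_x` on Fock space. -/
def fockNumber (Γ : Finset (Site d L)) : Fock d L →L[ℂ] Fock d L :=
  ∑ x ∈ Γ, create x ∘L annihilate x

/-- The Hilbert space of `N` fermions, i.e. the `N`-particle sector of Fock space, in the
occupation number representation. -/
abbrev NState (d L N : ℕ) : Type := EuclideanSpace ℂ {S : Finset (Site d L) // S.card = N}

/-- The inclusion of the `N`-particle sector into Fock space. -/
def incl (d L N : ℕ) : NState d L N →L[ℂ] Fock d L :=
  LinearMap.toContinuousLinearMap
    { toFun := fun ψ => WithLp.toLp 2 fun S => if h : S.card = N then ψ ⟨S, h⟩ else 0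
      map_add' := fun ψ φ => by
        ext S
        by_cases h : S.card = N <;> simp [h]
      map_smul' := fun a ψ => by
        ext S
        by_cases h : S.card = N <;> simp [h] }

/-- The operator on the `N`-particle sector given by an operator `A` on Fock space. The operators
`A` to which this is applied map the sector to itself (`incl_freeHamiltonian` and
`incl_numberOp` below), so that this is their restriction to the sector. -/
def onSector (N : ℕ) (A : Fock d L →L[ℂ] Fock d L) : NState d L N →L[ℂ] NState d L N :=
  LinearMap.toContinuousLinearMap
    { toFun := fun ψ => WithLp.toLp 2 fun S => A (incl d L N ψ) S.1
      map_add' := fun ψ φ => by ext S; simp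
      map_smul' := fun a ψ => by ext S; simp }

/-- The free Hamiltonian on the `N`-particle space. -/
def freeHamiltonian (d L N : ℕ) : NState d L N →L[ℂ] NState d L N :=
  onSector N (fockHamiltonian d L)

/-- The number operator `N_Γ` on the `N`-particle space. -/
def numberOp (N : ℕ) (Γ : Finset (Site d L)) : NState d L N →L[ℂ] NState d L N :=
  onSector N (fockNumber Γ)

lemma annihilate_apply (x : Site d L) (ψ : Fock d L) (S : Finset (Site d L)) :
    annihilate x ψ S = if x ∈ S then 0 else fermiSign x S * ψ (insert x S) := rfl

lemma incl_apply (N : ℕ) (ψ : NState d L N) (S : Finset (Site d L)) :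
    incl d L N ψ S = if h : S.card = N then ψ ⟨S, h⟩ else 0 := rfl

lemma create_annihilate_incl (N : ℕ) (x y : Site d L) (ψ : NState d L N)
    (S : Finset (Site d L)) (hS : S.card ≠ N) :
    create x (annihilate y (incl d L N ψ)) S = 0 := by
  have h1 : create x (annihilate y (incl d L N ψ)) S =
      inner ℂ (EuclideanSpace.single S (1 : ℂ)) (create x (annihilate y (incl d L N ψ))) := by
    simp [EuclideanSpace.inner_single_left]
  rw [h1, create, ContinuousLinearMap.adjoint_inner_right, PiLp.inner_apply]
  refine Finset.sum_eq_zero fun T _ => ?_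
  by_cases hT : T.card + 1 = N
  · have : annihilate x (EuclideanSpace.single S (1 : ℂ)) T = 0 := by
      rw [annihilate_apply]
      split_ifs with hx
      · rfl
      · have hne : insert x T ≠ S := by
          rintro rfl
          exact hS (by rw [Finset.card_insert_of_notMem hx, hT])
        simp [hne]
    simp [this]
  · have : annihilate y (incl d L N ψ) T = 0 := by
      rw [annihilate_apply]
      split_ifs with hy
      · rfl
      · rw [incl_apply, dif_neg (by rwa [Finset.card_insert_of_notMem hy]), mul_zero]
    simp [this]

lemma incl_onSector (N : ℕ) (A : Fock d L →L[ℂ] Fock d L) (ψ : NState d L N)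
    (h : ∀ S : Finset (Site d L), S.card ≠ N → A (incl d L N ψ) S = 0) :
    incl d L N (onSector N A ψ) = A (incl d L N ψ) := by
  ext S
  rw [incl_apply]
  split_ifs with hS
  · rfl
  · exact (h S hS).symm

/-- `freeHamiltonian` is the restriction of the Hamiltonian on Fock space. -/
lemma incl_freeHamiltonian (N : ℕ) (ψ : NState d L N) :
    incl d L N (freeHamiltonian d L N ψ) = fockHamiltonian d L (incl d L N ψ) := by
  refine incl_onSector N _ ψ fun S hS => ?_
  simp [fockHamiltonian, create_annihilate_incl N _ _ ψ S hS]

/-- `numberOp` is the restriction of the number operator on Fock space. -/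
lemma incl_numberOp (N : ℕ) (Γ : Finset (Site d L)) (ψ : NState d L N) :
    incl d L N (numberOp N Γ ψ) = fockNumber Γ (incl d L N ψ) := by
  refine incl_onSector N _ ψ fun S hS => ?_
  simp [fockNumber, create_annihilate_incl N _ _ ψ S hS]

/-- The relative size `μ = |Γ| / |Λ|` of the region `Γ`. -/
def relSize (Γ : Finset (Site d L)) : ℝ := (Γ.card : ℝ) / (Fintype.card (Site d L) : ℝ)

/-- `P_eq = 1_{[N (μ - η), N (μ + η)]}(N_Γ)`. -/
def eqProj (N : ℕ) (Γ : Finset (Site d L)) (η : ℝ) : NState d L N →L[ℂ] NState d L N :=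
  spectralProj (numberOp N Γ) (Icc (N * (relSize Γ - η)) (N * (relSize Γ + η)))

/-- `P_neq = 1 - P_eq`. -/
def neqProj (N : ℕ) (Γ : Finset (Site d L)) (η : ℝ) : NState d L N →L[ℂ] NState d L N :=
  1 - eqProj N Γ η

end FermiGas

end

/-! For an operator with simple spectrum and eigenbasis `φ`, the infinite time average of `|⟨a,
ψ_t⟩|²` with `ψ₀ = b` is `∑ₙ |⟨a, φₙ⟩|² |⟨b, φₙ⟩|²` (`limMean`, `tendsto_timeMean`); only the
distinctness of the eigenvalues matters, not that of their gaps. So `‖P_neq ψ_t‖²` is usually small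
if, on average, the eigenvectors of `H₀ + λV` have little weight in the range of `P_neq`.

`H₀` is highly degenerate, and as `λ → 0` the eigenvectors do not converge to an arbitrary
eigenbasis of `H₀` but to that of the block diagonal part `pinch H₀ e V`
(`IsEigenbasis.exists_limit`). For a continuous law this block diagonal part almost surely has
simple spectrum (`IsEigenbasis.ae_hasSimpleSpectrum_pinch`), which makes the limit unambiguous.

Invariance of the law makes the limiting eigenvectors uniformly distributed inside each eigenspace
of `H₀`, up to second moments of `|⟨a, φₙ⟩|²`. In an eigenspace of dimension `D` the mean transition
probability from a unit vector to itself is `2 / (D + 1)`, and Cauchy-Schwarz gives the same bound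
for two unit vectors (`meanTransition_self`, `meanTransition_le`). If some eigenbasis `Ψ` of `H₀`
satisfies `‖P Ψ_K‖² ≤ ε`, the trace of `P† P` over that eigenspace is at most `D ε`. The dimensions
cancel and the mean is at most `2ε` (`sum_meanTransition_le`). Markov's inequality over `V`, `ψ₀`
and `t` then yields the product `δ δ' δ''`; the constant is enlarged from `2` to `3` to pass from
the limit to small positive `λ` (`IsEigenbasis.thermalization`).

For the Fermi gas `Ψ` consists of Slater determinants of plane waves. The exponential moment of
`N_Γ` in such a state is a Gram determinant whose diagonal entries all equal `1 + (eᵗ - 1) μ`,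
because plane waves have constant modulus. The determinant of a positive semidefinite matrix is at
most the corresponding power of its mean diagonal entry, so the moment is dominated by that of `N`
independent Bernoulli variables, and a Chernoff bound gives `ε = 2 exp(-η² N / (3μ(1-μ)))`
(`norm_sq_neqProj_sectorSlater_le`). -/

namespace FermiGas

noncomputable section

set_option linter.unusedSectionVars false

/-! ### Time averages -/

/-- The average of `exp (i ω t)` over `[0, T]` tends to `1` for `ω = 0` and to `0` otherwise. -/
lemma tendsto_mean_exp (ω : ℝ) :
    Tendsto (fun T : ℝ => (T : ℂ)⁻¹ * ∫ t in (0 : ℝ)..T, Complex.exp (Complex.I * ω * t)) atTop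
      (𝓝 (if ω = 0 then 1 else 0)) := by
  split_ifs with h
  · subst h
    refine tendsto_const_nhds.congr' ?_
    filter_upwards [eventually_gt_atTop 0] with T hT
    have : (T : ℂ) ≠ 0 := by exact_mod_cast hT.ne'
    simp [this]
  · have hc : Complex.I * ω ≠ 0 := by simp [h]
    rw [tendsto_zero_iff_norm_tendsto_zero]
    have hlim : Tendsto (fun T : ℝ => T⁻¹ * (2 / |ω|)) atTop (𝓝 0) := by
      simpa using tendsto_inv_atTop_zero.mul_const (2 / |ω|)
    refine squeeze_zero' (Eventually.of_forall fun _ => norm_nonneg _) ?_ hlim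
    filter_upwards [eventually_gt_atTop 0] with T hT
    rw [integral_exp_mul_complex hc, norm_mul, norm_div, norm_inv, Complex.norm_real,
      Real.norm_of_nonneg hT.le]
    have h1 : ‖Complex.I * (ω : ℂ)‖ = |ω| := by simp
    rw [h1]
    gcongr
    refine (norm_sub_le _ _).trans ?_
    have h2 : ∀ s : ℝ, ‖Complex.exp (Complex.I * ω * s)‖ = 1 := fun s => by
      rw [show Complex.I * ω * s = ((ω * s : ℝ) : ℂ) * Complex.I by push_cast; ring]
      exact Complex.norm_exp_ofReal_mul_I _
    rw [h2, h2]
    norm_num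

section Evolution

variable {E : Type*} [NormedAddCommGroup E] [InnerProductSpace ℂ E] [FiniteDimensional ℂ E]
  [CompleteSpace E]

lemma evolve_eigenvector {H : E →L[ℂ] E} {φ : E} {e : ℝ} (h : H φ = (e : ℂ) • φ) (t : ℝ) :
    evolve H t φ = Complex.exp (-(Complex.I * e * t)) • φ := by
  set A : E →L[ℂ] E := (-(Complex.I * (t : ℂ))) • H with hA
  set c : ℂ := -(Complex.I * e * t) with hc
  have hAφ : A φ = c • φ := by
    rw [hA, smul_apply, h, smul_smul, hc]
    congr 1
    ring
  have hpow : ∀ n : ℕ, (A ^ n) φ = c ^ n • φ := by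
    intro n
    induction n with
    | zero => simp
    | succ k ih =>
      rw [pow_succ, mul_apply_eq_comp, hAφ, map_smul, ih, smul_smul, pow_succ']
  have h1 := (NormedSpace.exp_series_hasSum_exp' (𝕂 := ℂ) A).mapL
    (ContinuousLinearMap.apply ℂ E φ)
  have h2 := (NormedSpace.exp_series_hasSum_exp' (𝕂 := ℂ) c).smul_const φ
  have h3 : evolve H t φ = NormedSpace.exp A φ := rfl
  rw [h3, Complex.exp_eq_exp_ℂ]
  refine h1.unique (h2.congr_fun ?_)
  intro n
  simp [hpow, smul_smul]

lemma continuous_evolve :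
    Continuous fun p : (E →L[ℂ] E) × ℝ => evolve p.1 p.2 := by
  let _ : NormedAlgebra ℚ (E →L[ℂ] E) := NormedAlgebra.restrictScalars ℚ ℂ (E →L[ℂ] E)
  have h1 : Continuous fun p : (E →L[ℂ] E) × ℝ =>
      NormedSpace.exp ((-(Complex.I * (p.2 : ℂ))) • p.1) :=
    NormedSpace.exp_continuous.comp (by fun_prop)
  exact continuous_pi fun ψ => h1.clm_apply continuous_const

lemma continuous_evolve_apply (H : E →L[ℂ] E) (ψ : E) : Continuous fun t => evolve H t ψ :=
  (continuous_apply ψ).comp (continuous_evolve.comp (by fun_prop : Continuous fun t : ℝ => (H, t)))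

/-- The average over `[0, T]` of the transition probability `|⟨a, ψ_t⟩|²` with `ψ₀ = b`. -/
def timeMean (H : E →L[ℂ] E) (a b : E) (T : ℝ) : ℝ :=
  T⁻¹ * ∫ t in (0 : ℝ)..T, ‖inner ℂ a (evolve H t b)‖ ^ 2

lemma continuous_timeMean (a b : E) (T : ℝ) : Continuous fun H : E →L[ℂ] E => timeMean H a b T := by
  refine continuous_const.mul
    (intervalIntegral.continuous_parametric_intervalIntegral_of_continuous' ?_ 0 T)
  have := (continuous_apply b).comp (continuous_evolve (E := E))
  exact ((continuous_const.inner this).norm).pow 2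

/-- Expanded in the eigenbasis, the transition probability is a double sum of oscillations with
frequencies `e m - e n`. Injectivity of `e` means that averaging kills exactly the off-diagonal
terms. -/
lemma tendsto_timeMean {ι : Type*} [Fintype ι] {H : E →L[ℂ] E} (φ : OrthonormalBasis ι ℂ E)
    {e : ι → ℝ} (hφ : ∀ n, H (φ n) = (e n : ℂ) • φ n) (he : Function.Injective e) (a b : E) :
    Tendsto (timeMean H a b) atTop
      (𝓝 (∑ n, ‖inner ℂ a (φ n)‖ ^ 2 * ‖inner ℂ b (φ n)‖ ^ 2)) := by
  classical
  set c : ι → ℂ := fun n => inner ℂ a (φ n) * inner ℂ (φ n) b with hc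
  have h1 : ∀ t : ℝ, inner ℂ a (evolve H t b) =
      ∑ n, c n * Complex.exp (-(Complex.I * e n * t)) := by
    intro t
    conv_lhs => rw [← φ.sum_repr' b]
    rw [evolve, map_sum, inner_sum]
    refine Finset.sum_congr rfl fun n _ => ?_
    have := evolve_eigenvector (hφ n) t
    rw [evolve] at this
    rw [map_smul, this, inner_smul_right, inner_smul_right, hc]
    ring
  have h2 : ∀ t : ℝ, ((‖inner ℂ a (evolve H t b)‖ ^ 2 : ℝ) : ℂ) =
      ∑ n, ∑ m, c n * (starRingEnd ℂ) (c m) *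
        Complex.exp (Complex.I * ((e m - e n : ℝ) : ℂ) * t) := by
    intro t
    rw [Complex.ofReal_pow, ← Complex.mul_conj', h1, map_sum, Finset.sum_mul_sum]
    refine Finset.sum_congr rfl fun n _ => Finset.sum_congr rfl fun m _ => ?_
    rw [map_mul, ← Complex.exp_conj, mul_mul_mul_comm, ← Complex.exp_add]
    congr 2
    simp
    ring
  have h3 : ∀ T : ℝ, ((timeMean H a b T : ℝ) : ℂ) = ∑ n, ∑ m, c n * (starRingEnd ℂ) (c m) *
      ((T : ℂ)⁻¹ * ∫ t in (0 : ℝ)..T, Complex.exp (Complex.I * ((e m - e n : ℝ) : ℂ) * t)) := by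
    intro T
    rw [timeMean, Complex.ofReal_mul, ← intervalIntegral.integral_ofReal]
    simp_rw [h2]
    rw [intervalIntegral.integral_finsetSum
      fun n _ => (by fun_prop : Continuous _).intervalIntegrable _ _, Finset.mul_sum]
    · push_cast
      refine Finset.sum_congr rfl fun n _ => ?_
      rw [intervalIntegral.integral_finsetSum
        fun n _ => (by fun_prop : Continuous _).intervalIntegrable _ _, Finset.mul_sum]
      refine Finset.sum_congr rfl fun m _ => ?_
      rw [intervalIntegral.integral_const_mul]
      ring
  have h4 : Tendsto (fun T => ((timeMean H a b T : ℝ) : ℂ)) atTop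
      (𝓝 (∑ n, ∑ m, c n * (starRingEnd ℂ) (c m) * (if e m - e n = 0 then 1 else 0))) := by
    simp_rw [h3]
    exact tendsto_finsetSum _ fun n _ => tendsto_finsetSum _ fun m _ =>
      (tendsto_mean_exp (e m - e n)).const_mul _
  have h5 : (∑ n, ∑ m, c n * (starRingEnd ℂ) (c m) * (if e m - e n = 0 then 1 else 0)) =
      ((∑ n, ‖inner ℂ a (φ n)‖ ^ 2 * ‖inner ℂ b (φ n)‖ ^ 2 : ℝ) : ℂ) := by
    push_cast
    refine Finset.sum_congr rfl fun n _ => ?_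
    rw [Finset.sum_eq_single n]
    · rw [sub_self, if_pos rfl, mul_one, Complex.mul_conj', hc]
      simp only [norm_mul, norm_inner_symm (φ n) b]
      push_cast
      ring
    · intro m _ hm
      rw [if_neg, mul_zero]
      exact fun h => hm (he (sub_eq_zero.1 h))
    · simp
  rw [h5] at h4
  exact (Complex.continuous_re.tendsto _).comp h4

end Evolution

/-- If the time average of a nonnegative quantity `g` tends to at most `δ c`, then `g < c` at
most times. -/
lemma forMostTimes_of_tendsto {g : ℝ → ℝ} (hg : Continuous g) (hg0 : ∀ t, 0 ≤ g t) {F c δ : ℝ}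
    (hF : Tendsto (fun T : ℝ => T⁻¹ * ∫ t in (0 : ℝ)..T, g t) atTop (𝓝 F)) (hc : 0 < c)
    (hFc : F ≤ δ * c) : ForMostTimes δ fun t => g t < c := by
  have hlim : Tendsto (fun T : ℝ => ENNReal.ofReal (1 - (T⁻¹ * ∫ t in (0 : ℝ)..T, g t) / c)) atTop
      (𝓝 (ENNReal.ofReal (1 - F / c))) :=
    ENNReal.tendsto_ofReal (tendsto_const_nhds.sub (hF.div_const c))
  have h1 : ENNReal.ofReal (1 - δ) ≤ ENNReal.ofReal (1 - F / c) := by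
    apply ENNReal.ofReal_le_ofReal
    have : F / c ≤ δ := by rwa [div_le_iff₀ hc]
    linarith
  refine h1.trans ?_
  rw [← hlim.liminf_eq]
  -- At each fixed `T`, Markov's inequality on `[0, T]` bounds the fraction of good times below by
  -- `1 - mean / c`. That fraction itself need not converge, only the lower bound does.
  refine liminf_le_liminf ?_
  filter_upwards [eventually_gt_atTop 0] with T hT
  have hmeas : MeasurableSet {t | c ≤ g t} := measurableSet_le measurable_const hg.measurable
  have hint : IntegrableOn g (Icc 0 T) := hg.integrableOn_Icc
  have hmarkov := mul_meas_ge_le_integral_of_nonneg (μ := volume.restrict (Icc 0 T))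
    (ae_of_all _ hg0) hint c
  rw [integral_Icc_eq_integral_Ioc, ← intervalIntegral.integral_of_le hT.le,
    measureReal_restrict_apply hmeas] at hmarkov
  have hfin : volume (Icc 0 T ∩ {t | c ≤ g t}) ≠ ∞ :=
    ((measure_mono inter_subset_left).trans_lt (by simp : volume (Icc 0 T) < ∞)).ne
  have hset : {t : ℝ | t ∈ Icc 0 T ∧ g t < c} = Icc 0 T \ (Icc 0 T ∩ {t | c ≤ g t}) := by
    ext t
    simp only [Set.mem_ofPred_eq, Set.mem_sdiff, mem_inter_iff, not_and, not_le]
    tauto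
  have hvol : volume {t : ℝ | t ∈ Icc 0 T ∧ g t < c} =
      ENNReal.ofReal (T - volume.real ({t | c ≤ g t} ∩ Icc 0 T)) := by
    rw [hset, measure_sdiff inter_subset_left (measurableSet_Icc.inter hmeas).nullMeasurableSet hfin,
      Real.volume_Icc, sub_zero, ENNReal.ofReal_sub _ measureReal_nonneg, inter_comm,
      Measure.real, ENNReal.ofReal_toReal]
    rwa [inter_comm]
  rw [hvol, ← ENNReal.ofReal_div_of_pos hT]
  apply ENNReal.ofReal_le_ofReal
  rw [sub_div, div_self hT.ne']
  refine sub_le_sub_left ?_ 1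
  rw [div_le_div_iff₀ hT hc, mul_comm, mul_comm (T⁻¹), mul_assoc, inv_mul_cancel₀ hT.ne', mul_one]
  exact hmarkov

/-! ### Reflections -/

section Reflection

variable {E : Type*} [NormedAddCommGroup E] [InnerProductSpace ℂ E]

/-- The reflection in the hyperplane orthogonal to `w`. -/
def reflect (w : E) : E ≃ₗᵢ[ℂ] E := (ℂ ∙ w)ᗮ.reflection

lemma reflect_apply (w x : E) :
    reflect w x = x - (2 * (inner ℂ w x / (‖w‖ : ℂ) ^ 2)) • w := by
  have h := Submodule.reflection_singleton_apply (𝕜 := ℂ) w x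
  rw [reflect, Submodule.reflection_orthogonal]
  change -((ℂ ∙ w).reflection x) = _
  rw [h, two_smul, two_mul, add_smul]
  simp

/-- Equal norms and a real inner product make `a + b` orthogonal to `a - b`, so the reflection fixes
the sum and negates the difference. Over `ℂ` the reality condition is essential. -/
lemma reflect_sub_apply {a b : E} (hn : ‖a‖ = ‖b‖) (hr : (inner ℂ a b : ℂ).im = 0) :
    reflect (a - b) a = b := by
  have h0 : inner ℂ (a - b) (a + b) = 0 := by
    have h1 : inner ℂ b a = inner ℂ a b := by
      rw [← inner_conj_symm a b, Complex.conj_eq_iff_im.2]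
      rw [← inner_conj_symm, Complex.conj_im, hr, neg_zero]
    rw [inner_sub_left, inner_add_right, inner_add_right, inner_self_eq_norm_sq_to_K,
      inner_self_eq_norm_sq_to_K, hn, h1]
    ring
  have h1 : reflect (a - b) (a + b) = a + b := by
    rw [reflect_apply, h0]
    simp
  have h2 : reflect (a - b) (a - b) = -(a - b) :=
    Submodule.reflection_orthogonalComplement_singleton_eq_neg (𝕜 := ℂ) (a - b)
  have h3 : a = (2⁻¹ : ℂ) • ((a + b) + (a - b)) := by
    rw [show (a + b) + (a - b) = (2 : ℂ) • a by rw [two_smul]; abel, smul_smul]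
    norm_num
  conv_lhs => arg 2; rw [h3]
  rw [map_smul, map_add, h1, h2, show a + b + -(a - b) = (2 : ℂ) • b by rw [two_smul]; abel,
    smul_smul]
  norm_num

/-- Up to a phase, any vector can be reflected to any other vector of the same norm. -/
lemma exists_phase_reflect {a b : E} (hn : ‖a‖ = ‖b‖) :
    ∃ c : ℂ, ‖c‖ = 1 ∧ reflect (c • a - b) (c • a) = b := by
  obtain ⟨c, hc, h⟩ : ∃ c : ℂ, ‖c‖ = 1 ∧ (c * inner ℂ b a).im = 0 := by
    by_cases h0 : inner ℂ b a = 0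
    · exact ⟨1, by simp, by simp [h0]⟩
    · refine ⟨(starRingEnd ℂ) (inner ℂ b a) / ‖inner ℂ b a‖, ?_, ?_⟩
      · rw [norm_div, Complex.norm_conj, Complex.norm_real, norm_norm,
          div_self (norm_ne_zero_iff.2 h0)]
      · rw [div_mul_eq_mul_div, mul_comm, Complex.mul_conj']
        norm_cast
  refine ⟨c, hc, reflect_sub_apply (by rw [norm_smul, hc, one_mul, hn]) ?_⟩
  rw [← inner_conj_symm, inner_smul_right, Complex.conj_im, h, neg_zero]

end Reflection

/-! ### The uniform distribution on the unit sphere of a subspace -/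

section Sphere

/-- The image of Haar measure under `U` is again Haar, hence a multiple of the original; the
invariant unit ball forces the factor to be `1`. -/
lemma measurePreserving_addHaar {K : Type*} [NormedAddCommGroup K] [InnerProductSpace ℂ K]
    [FiniteDimensional ℂ K] [MeasurableSpace K] [BorelSpace K] (U : K ≃ₗᵢ[ℂ] K) :
    MeasurePreserving U (Measure.addHaar : Measure K) Measure.addHaar := by
  have : FiniteDimensional ℝ K := FiniteDimensional.complexToReal K
  refine ⟨U.continuous.measurable, ?_⟩
  have := Measure.isAddHaarMeasure_map (Measure.addHaar : Measure K)
    (U.toLinearEquiv : K →+ K) U.continuous U.surjective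
    U.toHomeomorph.isClosedEmbedding.tendsto_cocompact
  change (Measure.map U (Measure.addHaar : Measure K)).IsAddHaarMeasure at this
  have h1 := Measure.isAddLeftInvariant_eq_smul (Measure.map U (Measure.addHaar : Measure K))
    Measure.addHaar
  have h2 : Measure.map U (Measure.addHaar : Measure K) (Metric.ball 0 1) =
      (Measure.addHaar : Measure K) (Metric.ball 0 1) := by
    rw [Measure.map_apply U.continuous.measurable Metric.isOpen_ball.measurableSet,
      LinearIsometryEquiv.preimage_ball, map_zero]
  rw [h1]
  rw [h1, Measure.smul_apply, ENNReal.smul_def, smul_eq_mul] at h2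
  have hb0 : (Measure.addHaar : Measure K) (Metric.ball 0 1) ≠ 0 :=
    (Metric.measure_ball_pos _ _ one_pos).ne'
  have hb1 : (Measure.addHaar : Measure K) (Metric.ball 0 1) ≠ ∞ := measure_ball_lt_top.ne
  have h3 := (ENNReal.mul_eq_right hb0 hb1).1 h2
  rw [ENNReal.coe_eq_one.1 h3, one_smul]

variable {E : Type*} [NormedAddCommGroup E] [InnerProductSpace ℂ E] [FiniteDimensional ℂ E]
  [MeasurableSpace E] [BorelSpace E]

lemma isProbabilityMeasure_uniformSphere {K : Submodule ℂ E} (hK : K ≠ ⊥) :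
    IsProbabilityMeasure (uniformSphere K) := by
  have : Nontrivial K := Submodule.nontrivial_iff_ne_bot.2 hK
  have : FiniteDimensional ℝ K := FiniteDimensional.complexToReal K
  have h0 : (Measure.addHaar : Measure K).toSphere univ ≠ 0 :=
    Measure.measure_univ_ne_zero.2 (Measure.toSphere_ne_zero _)
  exact ⟨by rw [uniformSphere, Measure.smul_apply, smul_eq_mul,
    ENNReal.inv_mul_cancel h0 (measure_ne_top _ _)]⟩

/-- The action of a unitary on the unit sphere. -/
def sphereMap {K : Type*} [NormedAddCommGroup K] [InnerProductSpace ℂ K] (U : K ≃ₗᵢ[ℂ] K)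
    (x : Metric.sphere (0 : K) 1) : Metric.sphere (0 : K) 1 := ⟨U x, by simp⟩

/-- The sphere measure of a set is, up to a constant, the volume of the cone over it, and `U`
commutes with real scaling, so cones go to cones. -/
lemma measurePreserving_sphereMap (K : Submodule ℂ E) (U : K ≃ₗᵢ[ℂ] K) :
    MeasurePreserving (sphereMap U) (uniformSphere K) (uniformSphere K) := by
  have : FiniteDimensional ℝ K := FiniteDimensional.complexToReal K
  have hc : Continuous (sphereMap U) :=
    (U.continuous.comp continuous_subtype_val).subtype_mk _
  refine ⟨hc.measurable, ?_⟩
  rw [uniformSphere, Measure.map_smul]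
  congr 1
  ext s hs
  rw [Measure.map_apply hc.measurable hs, Measure.toSphere_apply' _ hs,
    Measure.toSphere_apply' _ (hc.measurable hs)]
  congr 1
  conv_rhs => rw [← (measurePreserving_addHaar U).measure_preimage_emb U.toHomeomorph.measurableEmbedding]
  congr 1
  ext x
  simp only [Set.mem_smul, mem_preimage, mem_image]
  constructor
  · rintro ⟨r, hr, y, ⟨z, hz, rfl⟩, rfl⟩
    exact ⟨r, hr, U z, ⟨_, hz, rfl⟩, (map_real_smul (U : K →+ K) U.continuous r (z : K)).symm⟩
  · rintro ⟨r, hr, y, ⟨z, hz, rfl⟩, hx⟩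
    refine ⟨r, hr, U.symm z, ⟨⟨U.symm z, by simp⟩, ?_, rfl⟩, ?_⟩
    · have : sphereMap U ⟨U.symm z, by simp⟩ = z := Subtype.ext (by simp [sphereMap])
      rw [this]
      exact hz
    · apply U.injective
      rw [← hx]
      have := map_real_smul (U : K →+ K) U.continuous r (U.symm (z : K))
      simpa using! this

/-- By unitary invariance the integral depends on `v` only through its norm. Over an orthonormal
basis the integrands sum to `1`, so each basis vector contributes `1 / dim K`. -/
lemma integral_uniformSphere_inner_self {κ : Type*} [Fintype κ] {K : Submodule ℂ E} (hK : K ≠ ⊥)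
    (u : OrthonormalBasis κ ℂ K) (v : K) :
    ∫ ψ, ‖(inner ℂ v ψ.1 : ℂ)‖ ^ 2 ∂uniformSphere K = (Fintype.card κ : ℝ)⁻¹ * ‖v‖ ^ 2 := by
  have := isProbabilityMeasure_uniformSphere hK
  have hcont : ∀ v : K, Continuous fun ψ : Metric.sphere (0 : K) 1 =>
      ‖(inner ℂ v ψ.1 : ℂ)‖ ^ 2 := fun v =>
    ((continuous_const.inner continuous_subtype_val).norm).pow 2
  have hint : ∀ v : K, Integrable (fun ψ : Metric.sphere (0 : K) 1 =>
      ‖(inner ℂ v ψ.1 : ℂ)‖ ^ 2) (uniformSphere K) := by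
    intro v
    refine Integrable.of_bound (hcont v).aestronglyMeasurable (‖v‖ ^ 2) (ae_of_all _ fun ψ => ?_)
    rw [Real.norm_of_nonneg (by positivity)]
    gcongr
    simpa using norm_inner_le_norm (𝕜 := ℂ) v ψ.1
  set I : K → ℝ := fun v => ∫ ψ, ‖(inner ℂ v ψ.1 : ℂ)‖ ^ 2 ∂uniformSphere K with hI
  have hsmul : ∀ (c : ℂ) (v : K), I (c • v) = ‖c‖ ^ 2 * I v := by
    intro c v
    simp only [hI]
    rw [← integral_const_mul]
    refine integral_congr_ae (ae_of_all _ fun ψ => ?_)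
    simp only [inner_smul_left, norm_mul, Complex.norm_conj, mul_pow]
  have hU : ∀ (U : K ≃ₗᵢ[ℂ] K) (v : K), I (U v) = I v := by
    intro U v
    have h := (measurePreserving_sphereMap K U)
    simp only [hI]
    rw [← h.map_eq, integral_map h.measurable.aemeasurable (hcont _).aestronglyMeasurable, h.map_eq]
    simp [sphereMap]
  have hconst : ∀ a b : K, ‖a‖ = ‖b‖ → I a = I b := by
    intro a b hab
    obtain ⟨c, hc, h⟩ := exists_phase_reflect hab
    rw [← h, hU, hsmul, hc]
    simp
  have hsum : ∑ k, I (u k) = 1 := by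
    simp only [hI]
    rw [← integral_finsetSum _ fun k _ => hint _]
    simp only [u.sum_sq_norm_inner_right]
    simp
  have : Nonempty κ := by
    by_contra h
    rw [not_nonempty_iff] at h
    simp at hsum
  have hcard : (Fintype.card κ : ℝ) ≠ 0 := by exact_mod_cast Fintype.card_ne_zero
  have hk : ∀ k, I (((‖v‖ : ℝ) : ℂ) • u k) = I v := fun k => hconst _ _ (by simp [norm_smul])
  have h1 : ∑ k : κ, I v = ‖v‖ ^ 2 := by
    have h2 : ∀ k, I v = ‖v‖ ^ 2 * I (u k) := fun k => by rw [← hk k, hsmul]; simp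
    rw [Finset.sum_congr rfl fun k _ => h2 k, ← Finset.mul_sum, hsum, mul_one]
  rw [Finset.sum_const, Finset.card_univ, nsmul_eq_mul] at h1
  change I v = _
  rw [← h1, inv_mul_cancel_left₀ hcard]

lemma integral_uniformSphere_inner {κ : Type*} [Fintype κ] {K : Submodule ℂ E} (hK : K ≠ ⊥)
    (u : OrthonormalBasis κ ℂ K) (a : E) :
    ∫ ψ, ‖(inner ℂ a (ψ.1 : E) : ℂ)‖ ^ 2 ∂uniformSphere K =
      (Fintype.card κ : ℝ)⁻¹ * ∑ k, ‖(inner ℂ a (u k : E) : ℂ)‖ ^ 2 := by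
  have h : ∀ x : K, inner ℂ a (x : E) = inner ℂ (K.orthogonalProjectionOnto a) x := fun x => by
    rw [Submodule.inner_orthogonalProjectionOnto_eq_of_mem_right]
  simp only [h]
  rw [integral_uniformSphere_inner_self hK u, u.sum_sq_norm_inner_left]

end Sphere

/-! ### Simple spectra -/

section Spectrum

variable {E : Type*} [NormedAddCommGroup E] [InnerProductSpace ℂ E] [FiniteDimensional ℂ E]

/-- `φ` is an orthonormal basis of eigenvectors of `H` with real eigenvalues `e`. -/
def IsEigenbasis {ι : Type*} [Fintype ι] (H : E →L[ℂ] E) (φ : OrthonormalBasis ι ℂ E)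
    (e : ι → ℝ) : Prop :=
  ∀ n, H (φ n) = (e n : ℂ) • φ n

/-- `H` has an orthonormal eigenbasis with distinct real eigenvalues. -/
def HasSimpleSpectrum (H : E →L[ℂ] E) : Prop :=
  ∃ (φ : OrthonormalBasis (Fin (Module.finrank ℂ E)) ℂ E) (e : Fin (Module.finrank ℂ E) → ℝ),
    IsEigenbasis H φ e ∧ Function.Injective e

variable {ι : Type*} [Fintype ι] {H : E →L[ℂ] E} {φ : OrthonormalBasis ι ℂ E} {e : ι → ℝ}

lemma IsEigenbasis.inner_apply (h : IsEigenbasis H φ e) (n : ι) (x : E) :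
    inner ℂ (φ n) (H x) = e n * inner ℂ (φ n) x := by
  classical
  conv_lhs => rw [← φ.sum_repr' x]
  rw [map_sum, inner_sum, Finset.sum_eq_single n]
  · rw [map_smul, h n, inner_smul_right, inner_smul_right, inner_self_eq_norm_sq_to_K, φ.norm_eq_one]
    simp [mul_comm]
  · intro m _ hm
    rw [map_smul, h m, inner_smul_right, inner_smul_right, φ.inner_eq_zero hm.symm]
    simp
  · simp

lemma IsEigenbasis.inner_comm (h : IsEigenbasis H φ e) (x y : E) :
    inner ℂ (H x) y = inner ℂ x (H y) := by
  rw [← φ.sum_inner_mul_inner, ← φ.sum_inner_mul_inner x]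
  refine Finset.sum_congr rfl fun n _ => ?_
  rw [← inner_conj_symm (H x), h.inner_apply, h.inner_apply, map_mul, Complex.conj_ofReal,
    inner_conj_symm]
  ring

lemma IsEigenbasis.inner_eq_zero_of_ne (h : IsEigenbasis H φ e) {x : E} {r : ℝ}
    (hx : H x = (r : ℂ) • x) {n : ι} (hn : e n ≠ r) : inner ℂ (φ n) x = 0 := by
  have h1 := h.inner_apply n x
  rw [hx, inner_smul_right] at h1
  have h2 : ((r : ℂ) - e n) * inner ℂ (φ n) x = 0 := by rw [sub_mul, h1, sub_self]
  refine (mul_eq_zero.1 h2).resolve_left fun h3 => hn ?_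
  exact_mod_cast (sub_eq_zero.1 h3).symm

lemma eq_zero_of_inner_eq_zero (φ : OrthonormalBasis ι ℂ E) {x : E}
    (h : ∀ n, inner ℂ (φ n) x = 0) : x = 0 := by
  rw [← φ.sum_repr' x]
  exact Finset.sum_eq_zero fun n _ => by rw [h n, zero_smul]

lemma IsEigenbasis.exists_eq (h : IsEigenbasis H φ e) {x : E} {r : ℝ}
    (hx : H x = (r : ℂ) • x) (h0 : x ≠ 0) : ∃ n, e n = r := by
  by_contra! hne
  exact h0 (eq_zero_of_inner_eq_zero φ fun n => h.inner_eq_zero_of_ne hx (hne n))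

/-- One-dimensionality of the eigenspaces, phrased through orthogonal vectors: this shows that
simplicity does not depend on the eigenbasis chosen, and that commuting operators are diagonalized
together. -/
lemma HasSimpleSpectrum.eq_zero_or_eq_zero (hH : HasSimpleSpectrum H) {x y : E} {r : ℝ}
    (hx : H x = (r : ℂ) • x) (hy : H y = (r : ℂ) • y) (hxy : inner ℂ x y = 0) :
    x = 0 ∨ y = 0 := by
  obtain ⟨φ, e, h, he⟩ := hH
  by_contra! h0
  obtain ⟨n, rfl⟩ := h.exists_eq hx h0.1
  have hx' : ∀ m, m ≠ n → inner ℂ (φ m) x = 0 := fun m hm => h.inner_eq_zero_of_ne hx (he.ne hm)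
  have hy' : ∀ m, m ≠ n → inner ℂ (φ m) y = 0 := fun m hm => h.inner_eq_zero_of_ne hy (he.ne hm)
  rw [← φ.sum_inner_mul_inner, Finset.sum_eq_single n (fun m _ hm => by rw [hy' m hm, mul_zero])
    (by simp), mul_eq_zero, ← inner_conj_symm, map_eq_zero] at hxy
  rcases hxy with h1 | h1
  · refine h0.1 (eq_zero_of_inner_eq_zero φ fun m => ?_)
    by_cases hm : m = n
    · rw [hm, h1]
    · exact hx' m hm
  · refine h0.2 (eq_zero_of_inner_eq_zero φ fun m => ?_)
    by_cases hm : m = n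
    · rw [hm, h1]
    · exact hy' m hm

lemma HasSimpleSpectrum.injective (hH : HasSimpleSpectrum H) (h : IsEigenbasis H φ e) :
    Function.Injective e := by
  intro n m hnm
  by_contra hne
  rcases hH.eq_zero_or_eq_zero (h n) (hnm ▸ h m) (φ.inner_eq_zero hne) with h0 | h0
  · exact φ.orthonormal.ne_zero n h0
  · exact φ.orthonormal.ne_zero m h0

/-- The infinite time average of the transition probability between `a` and `b`. -/
def limMean [CompleteSpace E] (H : E →L[ℂ] E) (a b : E) : ℝ := limUnder atTop (timeMean H a b)

lemma IsEigenbasis.limMean_eq [CompleteSpace E] (h : IsEigenbasis H φ e)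
    (he : Function.Injective e) (a b : E) :
    limMean H a b = ∑ n, ‖(inner ℂ a (φ n) : ℂ)‖ ^ 2 * ‖(inner ℂ b (φ n) : ℂ)‖ ^ 2 :=
  (tendsto_timeMean φ h he a b).limUnder_eq

lemma HasSimpleSpectrum.tendsto_timeMean [CompleteSpace E] (hH : HasSimpleSpectrum H) (a b : E) :
    Tendsto (timeMean H a b) atTop (𝓝 (limMean H a b)) := by
  obtain ⟨φ, e, h, he⟩ := hH
  rw [h.limMean_eq he]
  exact FermiGas.tendsto_timeMean φ h he a b

/-- An orthonormal family of the right size, as an orthonormal basis. -/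
lemma exists_orthonormalBasis_of_card {v : ι → E} (hv : Orthonormal ℂ v)
    (hc : Fintype.card ι = Module.finrank ℂ E) : ∃ φ : OrthonormalBasis ι ℂ E, ⇑φ = v := by
  refine ⟨OrthonormalBasis.mk hv ?_, OrthonormalBasis.coe_mk _ _⟩
  rw [hv.linearIndependent.span_eq_top_of_card_eq_finrank' hc]

/-- The orthogonal projection onto the eigenspace of `H` for `r`. -/
def eigProj (H : E →L[ℂ] E) (r : ℝ) : E →L[ℂ] E :=
  (Module.End.eigenspace (H : E →ₗ[ℂ] E) (r : ℂ)).starProjection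

lemma mem_eigenspace_iff {H : E →L[ℂ] E} {r : ℝ} {x : E} :
    x ∈ Module.End.eigenspace (H : E →ₗ[ℂ] E) (r : ℂ) ↔ H x = (r : ℂ) • x :=
  Module.End.mem_eigenspace_iff

lemma eigProj_eq_self_iff {r : ℝ} {x : E} : eigProj H r x = x ↔ H x = (r : ℂ) • x := by
  rw [eigProj, Submodule.starProjection_eq_self_iff, mem_eigenspace_iff]

lemma apply_eigProj (r : ℝ) (x : E) : H (eigProj H r x) = (r : ℂ) • eigProj H r x :=
  mem_eigenspace_iff.1 (Submodule.starProjection_apply_mem _ _)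

lemma inner_eigProj_comm (r : ℝ) (x y : E) :
    inner ℂ (eigProj H r x) y = inner ℂ x (eigProj H r y) :=
  Submodule.inner_starProjection_left_eq_right _ _ _

lemma IsEigenbasis.eigProj_apply_apply (h : IsEigenbasis H φ e) (r : ℝ) (x : E) :
    eigProj H r (H x) = (r : ℂ) • eigProj H r x := by
  refine ext_inner_left ℂ fun y => ?_
  rw [← inner_eigProj_comm, ← h.inner_comm, apply_eigProj, inner_smul_left, inner_smul_right,
    inner_eigProj_comm, Complex.conj_ofReal]

lemma IsEigenbasis.eigProj_eq_zero (h : IsEigenbasis H φ e) {r s : ℝ} (hrs : s ≠ r) {x : E}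
    (hx : H x = (s : ℂ) • x) : eigProj H r x = 0 := by
  have h1 := h.eigProj_apply_apply r x
  rw [hx, map_smul, ← sub_eq_zero, ← sub_smul, smul_eq_zero] at h1
  refine h1.resolve_left fun h2 => hrs ?_
  exact_mod_cast sub_eq_zero.1 h2

/-- The part of `V` that is block diagonal with respect to the eigenspaces of `H` for the
eigenvalues `e n`. -/
def pinch (H : E →L[ℂ] E) (e : ι → ℝ) (V : E →L[ℂ] E) : E →L[ℂ] E :=
  ∑ r ∈ Finset.univ.image e, eigProj H r * V * eigProj H r

lemma IsEigenbasis.pinch_apply (h : IsEigenbasis H φ e) (V : E →L[ℂ] E) {r : ℝ} {x : E}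
    (hx : H x = (r : ℂ) • x) : pinch H e V x = eigProj H r (V x) := by
  by_cases h0 : x = 0
  · simp [h0]
  have hr : r ∈ Finset.univ.image e := by simpa using h.exists_eq hx h0
  rw [pinch, sum_apply, Finset.sum_eq_single r]
  · change eigProj H r (V (eigProj H r x)) = _
    rw [eigProj_eq_self_iff.2 hx]
  · intro s _ hs
    change eigProj H s (V (eigProj H s x)) = _
    rw [h.eigProj_eq_zero hs.symm hx, map_zero, map_zero]
  · exact fun h => absurd hr h

end Spectrum

/-! ### First order perturbation theory -/

section Perturbation

variable {E : Type*} [NormedAddCommGroup E] [InnerProductSpace ℂ E] [FiniteDimensional ℂ E]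
  {ι : Type*} [Fintype ι] {H : E →L[ℂ] E} {Ψ : OrthonormalBasis ι ℂ E} {e : ι → ℝ}

lemma exists_isEigenbasis {A : E →L[ℂ] E} (hA : ∀ x y, inner ℂ (A x) y = inner ℂ x (A y)) :
    ∃ (φ : OrthonormalBasis (Fin (Module.finrank ℂ E)) ℂ E) (e : Fin (Module.finrank ℂ E) → ℝ),
      IsEigenbasis A φ e := by
  have hs : (A : E →ₗ[ℂ] E).IsSymmetric := hA
  exact ⟨hs.eigenvectorBasis rfl, hs.eigenvalues rfl, hs.apply_eigenvectorBasis rfl⟩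

/-- As `lam → 0` along an ultrafilter, eigenbases of `H + lam V` converge to an eigenbasis of the
block diagonal part of `V`, if this has simple spectrum. -/
lemma IsEigenbasis.exists_limit (h : IsEigenbasis H Ψ e) {V : E →L[ℂ] E}
    (hW : HasSimpleSpectrum (pinch H e V))
    {φ : ℝ → OrthonormalBasis (Fin (Module.finrank ℂ E)) ℂ E}
    {u : ℝ → Fin (Module.finrank ℂ E) → ℝ}
    (hφ : ∀ lam : ℝ, IsEigenbasis (H + (lam : ℂ) • V) (φ lam) (u lam))
    (𝒰 : Ultrafilter ℝ) (h𝒰 : (𝒰 : Filter ℝ) ≤ 𝓝[>] 0) :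
    ∃ (χ : OrthonormalBasis (Fin (Module.finrank ℂ E)) ℂ E) (v : Fin (Module.finrank ℂ E) → ℝ),
      IsEigenbasis (pinch H e V) χ v ∧ Function.Injective v ∧
      (∀ n, Tendsto (fun lam => φ lam n) 𝒰 (𝓝 (χ n))) ∧
      ∀ᶠ lam in (𝒰 : Filter ℝ), Function.Injective (u lam) := by
  have : ProperSpace E := FiniteDimensional.proper ℂ E
  have hlam : Tendsto (fun lam : ℝ => (lam : ℂ)) 𝒰 (𝓝 0) :=
    (Complex.continuous_ofReal.tendsto' (0 : ℝ) 0 (by simp)).mono_left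
      (h𝒰.trans nhdsWithin_le_nhds)
  have hpos : ∀ᶠ lam in (𝒰 : Filter ℝ), 0 < lam := h𝒰 self_mem_nhdsWithin
  -- Along an ultrafilter compactness of the unit ball yields limits at once, so the eigenvectors
  -- may be chosen arbitrarily for each `lam`, without any continuity.
  have hex : ∀ n, ∃ x, Tendsto (fun lam => φ lam n) 𝒰 (𝓝 x) := by
    intro n
    obtain ⟨x, -, hx⟩ := (isCompact_closedBall (0 : E) 1).ultrafilter_le_nhds
      (𝒰.map fun lam => φ lam n) (by
        rw [le_principal_iff]
        exact Ultrafilter.mem_map.2 (Eventually.of_forall fun lam => by simp))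
    exact ⟨x, hx⟩
  choose x hx using hex
  have hon : Orthonormal ℂ x := by
    classical
    rw [orthonormal_iff_ite]
    intro n m
    have h1 := (hx n).inner (𝕜 := ℂ) (hx m)
    refine tendsto_nhds_unique h1 (tendsto_const_nhds.congr fun lam => ?_)
    exact (orthonormal_iff_ite.1 (φ lam).orthonormal n m).symm
  obtain ⟨χ, rfl⟩ := exists_orthonormalBasis_of_card hon (by simp)
  have hAx : ∀ n, Tendsto (fun lam : ℝ => (u lam n : ℂ) • φ lam n) 𝒰 (𝓝 (H (χ n))) := by
    intro n
    have h1 : Tendsto (fun lam : ℝ => H (φ lam n) + (lam : ℂ) • V (φ lam n)) 𝒰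
        (𝓝 (H (χ n) + (0 : ℂ) • V (χ n))) :=
      ((H.continuous.tendsto _).comp (hx n)).add (hlam.smul ((V.continuous.tendsto _).comp (hx n)))
    rw [zero_smul, add_zero] at h1
    exact h1.congr fun lam => hφ lam n
  -- the eigenvalues converge to eigenvalues of `H`
  set e₀ : Fin (Module.finrank ℂ E) → ℝ := fun n => (inner ℂ (χ n) (H (χ n)) : ℂ).re with he₀
  have hu : ∀ n, Tendsto (fun lam => u lam n) 𝒰 (𝓝 (e₀ n)) := by
    intro n
    have h1 := (Complex.continuous_re.tendsto _).comp ((hx n).inner (𝕜 := ℂ) (hAx n))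
    refine h1.congr fun lam => ?_
    simp only [Function.comp_apply, inner_smul_right, inner_self_eq_norm_sq_to_K,
      OrthonormalBasis.norm_eq_one]
    simp
  have hH : ∀ n, H (χ n) = (e₀ n : ℂ) • χ n := fun n =>
    tendsto_nhds_unique (hAx n) (((Complex.continuous_ofReal.tendsto _).comp (hu n)).smul (hx n))
  -- the first order corrections converge
  set r : ℝ → Fin (Module.finrank ℂ E) → ℝ := fun lam n => (u lam n - e₀ n) / lam with hr
  -- The denominator equals `1`; it is displayed because `v n` arises as the limit of `⟨χ n, V (φ
  -- lam n)⟩ / ⟨χ n, φ lam n⟩`.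
  set v : Fin (Module.finrank ℂ E) → ℝ := fun n =>
    ((inner ℂ (χ n) (V (χ n)) : ℂ) / inner ℂ (χ n) (χ n)).re with hv
  -- Projecting the eigenvalue equation onto the eigenspace of `e₀ n` turns `H` into a scalar,
  -- leaving `lam • P V φ = (u - e₀) • P φ`. Dividing by `lam` gives the first order equation with
  -- no estimate on the components outside the eigenspace.
  have hproj : ∀ n, ∀ᶠ lam in (𝒰 : Filter ℝ), eigProj H (e₀ n) (V (φ lam n)) =
      (r lam n : ℂ) • eigProj H (e₀ n) (φ lam n) := by
    intro n
    filter_upwards [hpos] with lam hl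
    have hl' : (lam : ℂ) ≠ 0 := by exact_mod_cast hl.ne'
    have h1 := congrArg (eigProj H (e₀ n)) (hφ lam n)
    rw [add_apply, map_add, h.eigProj_apply_apply, smul_apply, map_smul, map_smul,
      ← eq_sub_iff_add_eq', ← sub_smul] at h1
    rw [hr]
    push_cast
    rw [div_eq_inv_mul, mul_smul, ← h1, smul_smul, inv_mul_cancel₀ hl', one_smul]
  have hinner : ∀ n y, inner ℂ (χ n) (eigProj H (e₀ n) y) = inner ℂ (χ n) y := by
    intro n y
    rw [← inner_eigProj_comm, eigProj_eq_self_iff.2 (hH n)]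
  have hrv : ∀ n, Tendsto (fun lam => r lam n) 𝒰 (𝓝 (v n)) := by
    intro n
    have hne : (inner ℂ (χ n) (χ n) : ℂ) ≠ 0 := by
      simp [inner_self_eq_norm_sq_to_K]
    have hden : Tendsto (fun lam => (inner ℂ (χ n) (φ lam n) : ℂ)) 𝒰
        (𝓝 (inner ℂ (χ n) (χ n))) := tendsto_const_nhds.inner (hx n)
    have hnum : Tendsto (fun lam => (inner ℂ (χ n) (V (φ lam n)) : ℂ)) 𝒰
        (𝓝 (inner ℂ (χ n) (V (χ n)))) :=
      tendsto_const_nhds.inner ((V.continuous.tendsto _).comp (hx n))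
    refine ((Complex.continuous_re.tendsto _).comp (hnum.div hden hne)).congr' ?_
    filter_upwards [hproj n, hden.eventually_ne hne] with lam h1 h2
    have h3 := congrArg (inner ℂ (χ n)) h1
    rw [inner_smul_right, hinner, hinner] at h3
    simp only [Function.comp_apply, Pi.div_apply]
    rw [h3, mul_div_cancel_right₀ _ h2, Complex.ofReal_re]
  have hWχ : IsEigenbasis (pinch H e V) χ v := by
    intro n
    rw [h.pinch_apply V (hH n)]
    have h1 : Tendsto (fun lam => eigProj H (e₀ n) (V (φ lam n))) 𝒰
        (𝓝 (eigProj H (e₀ n) (V (χ n)))) :=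
      ((eigProj H (e₀ n)).continuous.tendsto _).comp ((V.continuous.tendsto _).comp (hx n))
    have h2 : Tendsto (fun lam => (r lam n : ℂ) • eigProj H (e₀ n) (φ lam n)) 𝒰
        (𝓝 ((v n : ℂ) • eigProj H (e₀ n) (χ n))) :=
      ((Complex.continuous_ofReal.tendsto _).comp (hrv n)).smul
        (((eigProj H (e₀ n)).continuous.tendsto _).comp (hx n))
    rw [eigProj_eq_self_iff.2 (hH n)] at h2
    exact tendsto_nhds_unique h1 (h2.congr' ((hproj n).mono fun _ h => h.symm))
  have hvinj := hW.injective hWχ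
  refine ⟨χ, v, hWχ, hvinj, hx, ?_⟩
  -- Two eigenvalues are separated at order zero if their limits differ, and otherwise at first
  -- order, because the eigenvalues `v` of the block diagonal part are distinct.
  have hall : ∀ n m, n ≠ m → ∀ᶠ lam in (𝒰 : Filter ℝ), u lam n ≠ u lam m := by
    intro n m hnm
    by_cases hee : e₀ n = e₀ m
    · have h1 := (hrv n).sub (hrv m)
      filter_upwards [h1.eventually_ne (sub_ne_zero.2 (hvinj.ne hnm))] with lam h2 h3
      exact h2 (by simp [hr, h3, hee])
    · have h1 := (hu n).sub (hu m)
      filter_upwards [h1.eventually_ne (sub_ne_zero.2 hee)] with lam h2 h3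
      exact h2 (by simp [h3])
  have hall' : ∀ᶠ lam in (𝒰 : Filter ℝ), ∀ n m, n ≠ m → u lam n ≠ u lam m := by
    simp only [eventually_all]
    exact hall
  filter_upwards [hall'] with lam hl n m hnm
  by_contra hne
  exact hl n m hne hnm

variable [CompleteSpace E]

lemma IsEigenbasis.inner_comm_perturb (h : IsEigenbasis H Ψ e) {V : E →L[ℂ] E}
    (hV : IsSelfAdjoint V) (lam : ℝ) (x y : E) :
    inner ℂ ((H + (lam : ℂ) • V) x) y = inner ℂ x ((H + (lam : ℂ) • V) y) := by
  have hV' := (ContinuousLinearMap.isSelfAdjoint_iff_isSymmetric.1 hV) x y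
  simp only [ContinuousLinearMap.coe_coe] at hV'
  simp only [add_apply, smul_apply, inner_add_left, inner_add_right, inner_smul_left,
    inner_smul_right, h.inner_comm, hV', Complex.conj_ofReal]

lemma IsEigenbasis.eventually_hasSimpleSpectrum (h : IsEigenbasis H Ψ e) {V : E →L[ℂ] E}
    (hV : IsSelfAdjoint V) (hW : HasSimpleSpectrum (pinch H e V)) :
    ∀ᶠ lam : ℝ in 𝓝[>] 0, HasSimpleSpectrum (H + (lam : ℂ) • V) := by
  choose φ u hφ using fun lam : ℝ => exists_isEigenbasis (h.inner_comm_perturb hV lam)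
  refine mem_iff_ultrafilter.2 fun 𝒰 h𝒰 => ?_
  obtain ⟨-, -, -, -, -, hinj⟩ := h.exists_limit hW hφ 𝒰 h𝒰
  filter_upwards [hinj] with lam hl
  exact ⟨φ lam, u lam, hφ lam, hl⟩

/-- `limMean` jumps at degenerate operators: the limit is its value at the block diagonal part of
`V`, not at `H`. It does not depend on the ultrafilter, which gives convergence of the whole family.
-/
lemma IsEigenbasis.tendsto_limMean (h : IsEigenbasis H Ψ e) {V : E →L[ℂ] E}
    (hV : IsSelfAdjoint V) (hW : HasSimpleSpectrum (pinch H e V)) (a b : E) :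
    Tendsto (fun lam : ℝ => limMean (H + (lam : ℂ) • V) a b) (𝓝[>] 0)
      (𝓝 (limMean (pinch H e V) a b)) := by
  choose φ u hφ using fun lam : ℝ => exists_isEigenbasis (h.inner_comm_perturb hV lam)
  refine (tendsto_iff_ultrafilter _ _ _).2 fun 𝒰 h𝒰 => ?_
  obtain ⟨χ, v, hχ, hv, hlim, hinj⟩ := h.exists_limit hW hφ 𝒰 h𝒰
  rw [hχ.limMean_eq hv]
  have h1 : Tendsto (fun lam => ∑ n, ‖(inner ℂ a (φ lam n) : ℂ)‖ ^ 2 *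
      ‖(inner ℂ b (φ lam n) : ℂ)‖ ^ 2) 𝒰 (𝓝 (∑ n, ‖(inner ℂ a (χ n) : ℂ)‖ ^ 2 *
      ‖(inner ℂ b (χ n) : ℂ)‖ ^ 2)) :=
    tendsto_finsetSum _ fun n _ => (((tendsto_const_nhds.inner (hlim n)).norm).pow 2).mul
      (((tendsto_const_nhds.inner (hlim n)).norm).pow 2)
  refine h1.congr' ?_
  filter_upwards [hinj] with lam hl
  exact ((hφ lam).limMean_eq hl a b).symm

end Perturbation

/-! ### Krylov determinants -/

section Krylov

open Matrix

/-- The determinant of the vectors `B ^ k 1`, where `1` is the all-ones vector. -/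
def krylovDet {R : Type*} [CommRing R] {n : ℕ} (B : Matrix (Fin n) (Fin n) R) : R :=
  (Matrix.of fun i k : Fin n => (B ^ (k : ℕ) *ᵥ (1 : Fin n → R)) i).det

lemma map_krylovDet {R S : Type*} [CommRing R] [CommRing S] (f : R →+* S) {n : ℕ}
    (B : Matrix (Fin n) (Fin n) R) : f (krylovDet B) = krylovDet (f.mapMatrix B) := by
  rw [krylovDet, krylovDet, RingHom.map_det]
  congr 1
  ext i k
  have h1 : f ∘ (1 : Fin n → R) = 1 := by ext; simp
  simp only [RingHom.mapMatrix_apply, Matrix.map_apply, of_apply]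
  rw [RingHom.map_mulVec, h1, ← RingHom.mapMatrix_apply, map_pow]
  rfl

lemma krylovDet_smul {R : Type*} [CommRing R] {n : ℕ} (c : R) (B : Matrix (Fin n) (Fin n) R) :
    krylovDet (c • B) = (∏ k : Fin n, c ^ (k : ℕ)) * krylovDet B := by
  rw [krylovDet, krylovDet, ← det_mul_row]
  congr 1
  ext i k
  simp [smul_pow, smul_mulVec]

/-- Supplies a point where this polynomial in the matrix entries is nonzero: a diagonal matrix with
distinct entries. -/
lemma krylovDet_diagonal {R : Type*} [CommRing R] {n : ℕ} (x : Fin n → R) :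
    krylovDet (diagonal x) = (vandermonde x).det := by
  rw [krylovDet]
  congr 1
  ext i k
  simp [diagonal_pow, mulVec_diagonal, vandermonde_apply]

lemma continuous_krylovDet {n : ℕ} :
    Continuous (krylovDet : Matrix (Fin n) (Fin n) ℂ → ℂ) := by
  refine Continuous.matrix_det (continuous_matrix fun i k => ?_)
  exact (continuous_apply i).comp
    (Continuous.matrix_mulVec (continuous_id.pow (k : ℕ)) continuous_const)

/-- On the line `A + t D` the Krylov determinant vanishes only finitely often, if it is
nonzero for `D`. -/
lemma finite_krylovDet_eq_zero {n : ℕ} (A D : Matrix (Fin n) (Fin n) ℂ) (hD : krylovDet D ≠ 0) :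
    {t : ℝ | krylovDet (A + (t : ℂ) • D) = 0}.Finite := by
  -- By homogeneity `A + t D` may be replaced by `s A + D` with `s = 1 / t`. The resulting
  -- polynomial in `s` is nonzero since its value at `s = 0` is the determinant of `D`; the point `t
  -- = 0` is added by hand.
  set M : Matrix (Fin n) (Fin n) (Polynomial ℂ) :=
    (Polynomial.X : Polynomial ℂ) • (Polynomial.C.mapMatrix A) + Polynomial.C.mapMatrix D with hM
  have heval : ∀ s : ℂ, (krylovDet M).eval s = krylovDet (s • A + D) := by
    intro s
    rw [← Polynomial.coe_evalRingHom, map_krylovDet]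
    congr 1
    ext i j
    simp [hM]
    ring
  have hne : krylovDet M ≠ 0 := by
    intro h
    have := heval 0
    rw [h, Polynomial.eval_zero, zero_smul, zero_add] at this
    exact hD this.symm
  have hfin : {s : ℂ | (krylovDet M).IsRoot s}.Finite := Polynomial.finite_setOfPred_isRoot hne
  have hsub : {t : ℝ | krylovDet (A + (t : ℂ) • D) = 0} ⊆
      {0} ∪ (fun t : ℝ => ((t : ℂ))⁻¹) ⁻¹' {s : ℂ | (krylovDet M).IsRoot s} := by
    intro t ht
    by_cases h0 : t = 0
    · exact Or.inl h0
    · refine Or.inr ?_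
      have h0' : (t : ℂ) ≠ 0 := by exact_mod_cast h0
      change krylovDet (A + (t : ℂ) • D) = 0 at ht
      change (krylovDet M).eval ((t : ℂ)⁻¹) = 0
      have h1 : A + (t : ℂ) • D = (t : ℂ) • ((t : ℂ)⁻¹ • A + D) := by
        rw [smul_add, smul_smul, mul_inv_cancel₀ h0', one_smul]
      rw [h1, krylovDet_smul] at ht
      rw [heval]
      refine (mul_eq_zero.1 ht).resolve_left (Finset.prod_ne_zero_iff.2 fun k _ => ?_)
      exact pow_ne_zero _ h0'
  refine ((Set.finite_singleton 0).union (hfin.preimage ?_)).subset hsub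
  intro s _ t _ hst
  exact_mod_cast inv_injective hst

variable {E : Type*} [NormedAddCommGroup E] [InnerProductSpace ℂ E] [FiniteDimensional ℂ E]

/-- The matrix of an operator in an orthonormal basis. -/
def matrixOf {n : ℕ} (φ : OrthonormalBasis (Fin n) ℂ E) (W : E →L[ℂ] E) :
    Matrix (Fin n) (Fin n) ℂ :=
  Matrix.of fun i j => inner ℂ (φ i) (W (φ j))

lemma matrixOf_pow_mulVec_one {n : ℕ} (φ : OrthonormalBasis (Fin n) ℂ E) (W : E →L[ℂ] E) (k : ℕ)
    (i : Fin n) :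
    (matrixOf φ W ^ k *ᵥ (1 : Fin n → ℂ)) i = inner ℂ (φ i) ((W ^ k) (∑ j, φ j)) := by
  induction k generalizing i with
  | zero =>
    simp [orthonormal_iff_ite.1 φ.orthonormal]
  | succ k ih =>
    rw [pow_succ', ← mulVec_mulVec, pow_succ', mul_apply_eq_comp]
    conv_rhs => rw [← φ.sum_repr' ((W ^ k) (∑ j, φ j)), map_sum, inner_sum]
    rw [mulVec, dotProduct]
    refine Finset.sum_congr rfl fun j _ => ?_
    rw [ih, map_smul, inner_smul_right, mul_comm]
    rfl

/-- A repeated eigenvalue leaves an eigenvector orthogonal to `v = ∑ φ j`. It is then orthogonal to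
every `W ^ k v`, so these vectors cannot be independent. -/
lemma hasSimpleSpectrum_of_krylovDet_ne_zero
    (φ : OrthonormalBasis (Fin (Module.finrank ℂ E)) ℂ E) {W : E →L[ℂ] E}
    (hW : ∀ x y, inner ℂ (W x) y = inner ℂ x (W y)) (hdet : krylovDet (matrixOf φ W) ≠ 0) :
    HasSimpleSpectrum W := by
  obtain ⟨χ, u, hχ⟩ := exists_isEigenbasis hW
  refine ⟨χ, u, hχ, fun n m hnm => ?_⟩
  by_contra hne
  set v : E := ∑ j, φ j with hv
  -- In the plane spanned by `χ n` and `χ m` every vector is an eigenvector, and some nonzero one is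
  -- orthogonal to `v`.
  obtain ⟨w, hw0, hwv, hWw⟩ : ∃ w : E, w ≠ 0 ∧ inner ℂ w v = 0 ∧ W w = (u n : ℂ) • w := by
    by_cases h0 : inner ℂ (χ n) v = 0
    · exact ⟨χ n, χ.orthonormal.ne_zero n, h0, hχ n⟩
    · refine ⟨inner ℂ v (χ m) • χ n - inner ℂ v (χ n) • χ m, fun h => ?_, ?_, ?_⟩
      · have h1 := congrArg (inner ℂ (χ m)) h
        rw [inner_sub_right, inner_smul_right, inner_smul_right, inner_zero_right,
          χ.inner_eq_zero (Ne.symm hne), inner_self_eq_norm_sq_to_K, χ.norm_eq_one] at h1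
        apply h0
        rw [← inner_conj_symm, map_eq_zero]
        simpa using h1
      · rw [inner_sub_left, inner_smul_left, inner_smul_left, inner_conj_symm, inner_conj_symm]
        ring
      · rw [map_sub, map_smul, map_smul, hχ n, hχ m, ← hnm, smul_sub, smul_comm,
          smul_comm (inner ℂ v (χ n))]
  have hpow : ∀ k : ℕ, inner ℂ w ((W ^ k) v) = 0 := by
    intro k
    induction k with
    | zero => simpa using hwv
    | succ k ih =>
      rw [pow_succ', mul_apply_eq_comp, ← hW, hWw, inner_smul_left, ih, mul_zero]
  refine hdet (exists_vecMul_eq_zero_iff.1 ⟨fun i => inner ℂ w (φ i), fun h => hw0 ?_, ?_⟩)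
  · refine eq_zero_of_inner_eq_zero φ fun i => ?_
    rw [← inner_conj_symm, map_eq_zero]
    exact congrFun h i
  · ext k
    rw [Pi.zero_apply, ← hpow k, ← φ.sum_inner_mul_inner, vecMul, dotProduct]
    refine Finset.sum_congr rfl fun i _ => ?_
    rw [of_apply, matrixOf_pow_mulVec_one]

lemma continuous_matrixOf {n : ℕ} (φ : OrthonormalBasis (Fin n) ℂ E) :
    Continuous (matrixOf φ) := by
  refine continuous_matrix fun i j => ?_
  exact continuous_const.inner (ContinuousLinearMap.apply ℂ E (φ j)).continuous

end Krylov

/-! ### Generic simplicity of the spectrum of the block diagonal part. -/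

section Generic

variable {E : Type*} [NormedAddCommGroup E] [InnerProductSpace ℂ E] [FiniteDimensional ℂ E]
  {ι : Type*} [Fintype ι] {H : E →L[ℂ] E} {Ψ : OrthonormalBasis ι ℂ E} {e : ι → ℝ}

lemma pinch_add (V V' : E →L[ℂ] E) : pinch H e (V + V') = pinch H e V + pinch H e V' := by
  simp [pinch, mul_add, add_mul, Finset.sum_add_distrib]

lemma pinch_smul (c : ℂ) (V : E →L[ℂ] E) : pinch H e (c • V) = c • pinch H e V := by
  simp [pinch, Finset.smul_sum]

lemma continuous_pinch : Continuous (pinch H e) := by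
  unfold pinch
  fun_prop

lemma inner_pinch_comm {V : E →L[ℂ] E} (hV : ∀ x y, inner ℂ (V x) y = inner ℂ x (V y)) (x y : E) :
    inner ℂ (pinch H e V x) y = inner ℂ x (pinch H e V y) := by
  simp only [pinch, sum_apply, sum_inner, inner_sum, mul_apply_eq_comp, inner_eigProj_comm, hV]

variable [CompleteSpace E]

lemma inner_selfAdjoint_comm (V : selfAdjoint (E →L[ℂ] E)) (x y : E) :
    inner ℂ ((V : E →L[ℂ] E) x) y = inner ℂ x ((V : E →L[ℂ] E) y) :=
  (ContinuousLinearMap.isSelfAdjoint_iff_isSymmetric.1 V.2) x y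

lemma IsEigenbasis.isSelfAdjoint (h : IsEigenbasis H Ψ e) : IsSelfAdjoint H :=
  ContinuousLinearMap.isSelfAdjoint_iff_isSymmetric.2 h.inner_comm

/-- For almost every self-adjoint `V`, the block diagonal part of `V` has simple spectrum. -/
theorem IsEigenbasis.ae_hasSimpleSpectrum_pinch (h : IsEigenbasis H Ψ e) :
    ∀ᵐ V : selfAdjoint (E →L[ℂ] E) ∂Measure.addHaar,
      HasSimpleSpectrum (pinch H e (V : E →L[ℂ] E)) := by
  obtain ⟨φ, ε, hφ⟩ := exists_isEigenbasis h.inner_comm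
  set x : Fin (Module.finrank ℂ E) → ℝ := fun i => (i : ℝ) with hx
  -- `D` is diagonal in an eigenbasis of `H`, so pinching does not change it, and its entries `0, 1,
  -- 2, …` are distinct.
  set D : E →L[ℂ] E := LinearMap.toContinuousLinearMap
    (φ.toBasis.constr ℂ fun i => (x i : ℂ) • φ i) with hDdef
  have hD : IsEigenbasis D φ x := by
    intro i
    have := φ.toBasis.constr_basis ℂ (fun i => (x i : ℂ) • φ i) i
    rwa [φ.coe_toBasis] at this
  have hpD : ∀ i, pinch H e D (φ i) = (x i : ℂ) • φ i := by
    intro i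
    rw [h.pinch_apply D (hφ i), hD i, map_smul, eigProj_eq_self_iff.2 (hφ i)]
  have hmD : matrixOf φ (pinch H e D) = Matrix.diagonal fun i => (x i : ℂ) := by
    ext i j
    rw [matrixOf, Matrix.of_apply, hpD, inner_smul_right, orthonormal_iff_ite.1 φ.orthonormal,
      Matrix.diagonal_apply]
    split_ifs with hij <;> simp [hij]
  have hkD : krylovDet (matrixOf φ (pinch H e D)) ≠ 0 := by
    rw [hmD, krylovDet_diagonal, Matrix.det_vandermonde_ne_zero_iff]
    intro i j hij
    have : (x i : ℂ) = x j := hij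
    simp only [hx] at this
    exact Fin.ext (by exact_mod_cast this)
  set f : selfAdjoint (E →L[ℂ] E) → ℂ :=
    fun V => krylovDet (matrixOf φ (pinch H e (V : E →L[ℂ] E))) with hf
  have hfc : Continuous f := continuous_krylovDet.comp
    ((continuous_matrixOf φ).comp (continuous_pinch.comp continuous_subtype_val))
  have hmeas : MeasurableSet {V | f V ≠ 0} := (isOpen_ne_fun hfc continuous_const).measurableSet
  -- A Fubini argument: every line in direction `D` meets the exceptional set in finitely many
  -- points, so that set is Lebesgue null.
  have key := ae_mem_of_ae_add_linearMap_mem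
    (LinearMap.toSpanSingleton ℝ _ (⟨D, hD.isSelfAdjoint⟩ : selfAdjoint (E →L[ℂ] E)))
    (volume : Measure ℝ) (Measure.addHaar : Measure (selfAdjoint (E →L[ℂ] E))) hmeas (by
      intro V
      have hfin := finite_krylovDet_eq_zero (matrixOf φ (pinch H e (V : E →L[ℂ] E))) _ hkD
      rw [ae_iff]
      refine (hfin.subset fun t ht => ?_).measure_zero volume
      simp only [ne_eq, mem_ofPred_eq, not_not] at ht ⊢
      rw [← ht, hf]
      change _ = krylovDet (matrixOf φ (pinch H e ((V : E →L[ℂ] E) + t • D)))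
      congr 1
      have : t • D = (t : ℂ) • D := (RCLike.real_smul_eq_coe_smul (K := ℂ) t D)
      rw [this, pinch_add, pinch_smul]
      ext i j
      simp [matrixOf])
  filter_upwards [key] with V hV
  exact hasSimpleSpectrum_of_krylovDet_ne_zero φ (inner_pinch_comm (inner_selfAdjoint_comm V)) hV

end Generic

section Pointwise

variable {E : Type*} [NormedAddCommGroup E] [InnerProductSpace ℂ E] [FiniteDimensional ℂ E]
  {ι : Type*} [Fintype ι] {H : E →L[ℂ] E} {Ψ : OrthonormalBasis ι ℂ E} {e : ι → ℝ}

/-! ### Time averages for a block diagonal operator with simple spectrum -/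

/-- An operator commuting with an operator with simple spectrum is diagonal in its eigenbasis. -/
lemma IsEigenbasis.exists_isEigenbasis_of_pinch (h : IsEigenbasis H Ψ e) {V : E →L[ℂ] E}
    (hW : HasSimpleSpectrum (pinch H e V)) {κ : Type*} [Fintype κ] {χ : OrthonormalBasis κ ℂ E}
    {v : κ → ℝ} (hχ : IsEigenbasis (pinch H e V) χ v) : ∃ c : κ → ℝ, IsEigenbasis H χ c := by
  have hcomm : ∀ x, pinch H e V (H x) = H (pinch H e V x) := by
    intro x
    simp only [pinch, sum_apply, mul_apply_eq_comp, map_sum, h.eigProj_apply_apply, apply_eigProj,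
      map_smul]
  refine ⟨fun n => (inner ℂ (χ n) (H (χ n)) : ℂ).re, fun n => ?_⟩
  have hreal : (((inner ℂ (χ n) (H (χ n)) : ℂ).re : ℝ) : ℂ) = inner ℂ (χ n) (H (χ n)) := by
    refine Complex.conj_eq_iff_re.1 ?_
    rw [inner_conj_symm, h.inner_comm]
  rw [hreal]
  set c : ℂ := inner ℂ (χ n) (H (χ n)) with hc
  -- The part of `H (χ n)` orthogonal to `χ n` is again in the eigenspace of the pinching for `v n`;
  -- simplicity forces it to vanish.
  have h1 : pinch H e V (H (χ n) - c • χ n) = (v n : ℂ) • (H (χ n) - c • χ n) := by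
    rw [map_sub, hcomm, map_smul, hχ n, map_smul, smul_sub, smul_comm c]
  have h2 : inner ℂ (χ n) (H (χ n) - c • χ n) = 0 := by
    rw [inner_sub_right, inner_smul_right, inner_self_eq_norm_sq_to_K, χ.norm_eq_one, ← hc]
    simp
  rcases hW.eq_zero_or_eq_zero (hχ n) h1 h2 with h3 | h3
  · exact absurd h3 (χ.orthonormal.ne_zero n)
  · exact sub_eq_zero.1 h3

lemma IsEigenbasis.norm_sq_eigProj (h : IsEigenbasis H Ψ e) (r : ℝ) (x : E) :
    ‖eigProj H r x‖ ^ 2 = ∑ K with e K = r, ‖(inner ℂ (Ψ K) x : ℂ)‖ ^ 2 := by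
  rw [← Ψ.sum_sq_norm_inner_right, Finset.sum_filter]
  refine Finset.sum_congr rfl fun K _ => ?_
  rw [← inner_eigProj_comm]
  split_ifs with hK
  · rw [eigProj_eq_self_iff.2 (hK ▸ h K)]
  · rw [h.eigProj_eq_zero hK (h K)]
    simp

lemma IsEigenbasis.sum_norm_sq_eigProj (h : IsEigenbasis H Ψ e) (x : E) :
    ∑ r ∈ Finset.univ.image e, ‖eigProj H r x‖ ^ 2 = ‖x‖ ^ 2 := by
  simp_rw [h.norm_sq_eigProj]
  rw [← Ψ.sum_sq_norm_inner_right]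
  exact Finset.sum_fiberwise_of_maps_to (fun K _ => Finset.mem_image_of_mem e (Finset.mem_univ K)) _

variable [CompleteSpace E]

namespace HasSimpleSpectrum

lemma limMean_nonneg (hH : HasSimpleSpectrum H) (a b : E) : 0 ≤ limMean H a b := by
  obtain ⟨φ, u, h, hu⟩ := hH
  rw [h.limMean_eq hu]
  positivity

lemma limMean_le (hH : HasSimpleSpectrum H) (a b : E) : limMean H a b ≤ ‖a‖ ^ 2 * ‖b‖ ^ 2 := by
  obtain ⟨φ, u, h, hu⟩ := hH
  rw [h.limMean_eq hu, ← φ.sum_sq_norm_inner_left b, Finset.mul_sum]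
  refine Finset.sum_le_sum fun n _ => ?_
  gcongr
  simpa using norm_inner_le_norm (𝕜 := ℂ) a (φ n)

lemma limMean_smul (hH : HasSimpleSpectrum H) (z w : ℂ) (a b : E) :
    limMean H (z • a) (w • b) = ‖z‖ ^ 2 * ‖w‖ ^ 2 * limMean H a b := by
  obtain ⟨φ, u, h, hu⟩ := hH
  rw [h.limMean_eq hu, h.limMean_eq hu, Finset.mul_sum]
  refine Finset.sum_congr rfl fun n _ => ?_
  rw [inner_smul_left, inner_smul_left, norm_mul, norm_mul, Complex.norm_conj, Complex.norm_conj]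
  ring

lemma two_mul_limMean_le (hH : HasSimpleSpectrum H) (a b : E) :
    2 * limMean H a b ≤ limMean H a a + limMean H b b := by
  obtain ⟨φ, u, h, hu⟩ := hH
  rw [h.limMean_eq hu, h.limMean_eq hu, h.limMean_eq hu, Finset.mul_sum, ← Finset.sum_add_distrib]
  refine Finset.sum_le_sum fun n _ => ?_
  nlinarith [sq_nonneg (‖(inner ℂ a (φ n) : ℂ)‖ ^ 2 - ‖(inner ℂ b (φ n) : ℂ)‖ ^ 2)]

/-- Averaging `|x + z y|⁴` over `z ∈ {1, -1, i, -i}` gives `|x|⁴ + |y|⁴ + 4 |x|² |y|²`. This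
recovers mixed moments from diagonal ones. -/
lemma limMean_parallelogram (hH : HasSimpleSpectrum H) (a b : E) :
    limMean H (a + b) (a + b) + limMean H (a - b) (a - b) +
      (limMean H (a + Complex.I • b) (a + Complex.I • b) +
        limMean H (a - Complex.I • b) (a - Complex.I • b)) =
    4 * (limMean H a a + limMean H b b + 4 * limMean H a b) := by
  obtain ⟨φ, u, h, hu⟩ := hH
  simp only [h.limMean_eq hu]
  rw [Finset.mul_sum, ← Finset.sum_add_distrib, ← Finset.sum_add_distrib,
    ← Finset.sum_add_distrib, ← Finset.sum_add_distrib, ← Finset.sum_add_distrib, Finset.mul_sum]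
  refine Finset.sum_congr rfl fun n _ => ?_
  simp only [inner_add_left, inner_sub_left, inner_smul_left, Complex.conj_I]
  generalize (inner ℂ a (φ n) : ℂ) = x
  generalize (inner ℂ b (φ n) : ℂ) = y
  simp only [Complex.sq_norm, Complex.normSq_apply]
  simp
  ring

end HasSimpleSpectrum

/-- Each `χ n` is also an eigenvector of `H`. It lies in the eigenspace of `r`, where the `Ψ K`
capture all of it, or else it is orthogonal to `a`. -/
lemma IsEigenbasis.sum_limMean (h : IsEigenbasis H Ψ e) {V : E →L[ℂ] E}
    (hW : HasSimpleSpectrum (pinch H e V)) {r : ℝ} {a : E} (ha : H a = (r : ℂ) • a) :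
    ∑ K with e K = r, limMean (pinch H e V) a (Ψ K) = ‖a‖ ^ 2 := by
  obtain ⟨χ, v, hχ, hv⟩ := id hW
  obtain ⟨c, hc⟩ := h.exists_isEigenbasis_of_pinch hW hχ
  simp_rw [hχ.limMean_eq hv]
  rw [Finset.sum_comm, ← χ.sum_sq_norm_inner_left]
  refine Finset.sum_congr rfl fun n _ => ?_
  rw [← Finset.mul_sum, ← h.norm_sq_eigProj]
  by_cases hn : c n = r
  · rw [eigProj_eq_self_iff.2 (hn ▸ hc n), χ.norm_eq_one]
    simp
  · rw [← inner_conj_symm, hc.inner_eq_zero_of_ne ha hn]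
    simp

/-- Each eigenvector of the pinching lies in a single eigenspace of `H` and sees only that component
of `a` and `b`. -/
lemma IsEigenbasis.limMean_pinch_eq_sum (h : IsEigenbasis H Ψ e) {V : E →L[ℂ] E}
    (hW : HasSimpleSpectrum (pinch H e V)) (a b : E) :
    limMean (pinch H e V) a b =
      ∑ r ∈ Finset.univ.image e, limMean (pinch H e V) (eigProj H r a) (eigProj H r b) := by
  obtain ⟨χ, v, hχ, hv⟩ := id hW
  obtain ⟨c, hc⟩ := h.exists_isEigenbasis_of_pinch hW hχ
  simp_rw [hχ.limMean_eq hv]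
  rw [Finset.sum_comm]
  refine Finset.sum_congr rfl fun n _ => ?_
  have hmem : c n ∈ Finset.univ.image e := by
    simpa using h.exists_eq (hc n) (χ.orthonormal.ne_zero n)
  rw [Finset.sum_eq_single (c n)]
  · rw [inner_eigProj_comm, inner_eigProj_comm, eigProj_eq_self_iff.2 (hc n)]
  · intro r _ hr
    rw [inner_eigProj_comm, h.eigProj_eq_zero hr.symm (hc n)]
    simp
  · exact fun h => absurd hmem h

end Pointwise

/-! ### Invariance -/

section Invariance

variable {E : Type*} [NormedAddCommGroup E] [InnerProductSpace ℂ E] [FiniteDimensional ℂ E]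
  [CompleteSpace E] {ι : Type*} [Fintype ι] {H : E →L[ℂ] E} {Ψ : OrthonormalBasis ι ℂ E} {e : ι → ℝ}

lemma IsEigenbasis.reflect_apply_apply (h : IsEigenbasis H Ψ e) {w : E} {r : ℝ}
    (hw : H w = (r : ℂ) • w) (x : E) : reflect w (H x) = H (reflect w x) := by
  rw [reflect_apply, reflect_apply, map_sub, map_smul, hw, smul_smul, ← h.inner_comm, hw,
    inner_smul_left, Complex.conj_ofReal]
  congr 2
  ring

/-- Both `U` and its inverse preserve the eigenspace; the projection is self-adjoint, so it commutes
with `U`. -/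
lemma eigProj_isometry_apply (U : E ≃ₗᵢ[ℂ] E) (hU : ∀ x, U (H x) = H (U x)) (r : ℝ) (x : E) :
    eigProj H r (U x) = U (eigProj H r x) := by
  have hU' : ∀ x, U.symm (H x) = H (U.symm x) := fun x => by
    apply U.injective
    rw [hU, U.apply_symm_apply, U.apply_symm_apply]
  have h1 : ∀ y, eigProj H r (U (eigProj H r y)) = U (eigProj H r y) := fun y => by
    rw [eigProj_eq_self_iff, ← hU, apply_eigProj, map_smul]
  have h2 : ∀ y, eigProj H r (U.symm (eigProj H r y)) = U.symm (eigProj H r y) := fun y => by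
    rw [eigProj_eq_self_iff, ← hU', apply_eigProj, map_smul]
  refine ext_inner_left ℂ fun y => ?_
  have hflip : ∀ y z, inner ℂ y (U z) = inner ℂ (U.symm y) z := fun y z => by
    rw [LinearIsometryEquiv.inner_map_eq_flip, LinearIsometryEquiv.symm_symm]
  rw [← inner_eigProj_comm, hflip, ← h2, inner_eigProj_comm, ← hflip, inner_eigProj_comm, h1]

/-- A linear isometry as an element of the unitary group. -/
lemma isometry_mem_unitary (U : E ≃ₗᵢ[ℂ] E) : (U : E →L[ℂ] E) ∈ unitary (E →L[ℂ] E) := by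
  rw [← Unitary.coe_symm_linearIsometryEquiv_apply]
  exact (Unitary.linearIsometryEquiv.symm U).2

lemma star_isometry_apply (U : E ≃ₗᵢ[ℂ] E) (x : E) : star (U : E →L[ℂ] E) x = U.symm x := by
  refine ext_inner_left ℂ fun y => ?_
  rw [ContinuousLinearMap.star_eq_adjoint, ContinuousLinearMap.adjoint_inner_right]
  exact U.inner_map_eq_flip y x

lemma pinch_conjBy (U : E ≃ₗᵢ[ℂ] E) (hU : ∀ x, U (H x) = H (U x))
    (V : selfAdjoint (E →L[ℂ] E)) (x : E) :
    pinch H e (conjBy (U : E →L[ℂ] E) V : E →L[ℂ] E) (U x) = U (pinch H e (V : E →L[ℂ] E) x) := by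
  have h1 : ∀ y, (conjBy (U : E →L[ℂ] E) V : E →L[ℂ] E) (U y) = U ((V : E →L[ℂ] E) y) := by
    intro y
    change (U : E →L[ℂ] E) ((V : E →L[ℂ] E) (star (U : E →L[ℂ] E) (U y))) = _
    rw [star_isometry_apply, U.symm_apply_apply]
    rfl
  simp only [pinch, sum_apply, mul_apply_eq_comp, map_sum, eigProj_isometry_apply U hU, h1]

lemma limMean_pinch_conjBy (U : E ≃ₗᵢ[ℂ] E) (hU : ∀ x, U (H x) = H (U x))
    {V : selfAdjoint (E →L[ℂ] E)} (hW : HasSimpleSpectrum (pinch H e (V : E →L[ℂ] E))) (a b : E) :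
    limMean (pinch H e (conjBy (U : E →L[ℂ] E) V : E →L[ℂ] E)) (U a) (U b) =
      limMean (pinch H e (V : E →L[ℂ] E)) a b := by
  obtain ⟨χ, v, hχ, hv⟩ := hW
  have hχ' : IsEigenbasis (pinch H e (conjBy (U : E →L[ℂ] E) V : E →L[ℂ] E)) (χ.map U) v := by
    intro n
    rw [OrthonormalBasis.map_apply, pinch_conjBy U hU, hχ n, map_smul]
  rw [hχ.limMean_eq hv, hχ'.limMean_eq hv]
  simp

lemma measurable_conjBy (U : E →L[ℂ] E) : Measurable (conjBy U) := by
  refine Continuous.measurable (Continuous.subtype_mk ?_ _)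
  fun_prop

variable {ρ : Measure (selfAdjoint (E →L[ℂ] E))}

lemma IsEigenbasis.ae_hasSimpleSpectrum (h : IsEigenbasis H Ψ e) (hρc : IsContinuousLaw ρ) :
    ∀ᵐ V : selfAdjoint (E →L[ℂ] E) ∂ρ, HasSimpleSpectrum (pinch H e (V : E →L[ℂ] E)) :=
  hρc.ae_le h.ae_hasSimpleSpectrum_pinch

/-- As an almost everywhere limit of finite time averages, which are continuous in `V`, the function
is measurable without any measurable selection of eigenvectors. -/
lemma IsEigenbasis.aestronglyMeasurable_limMean (h : IsEigenbasis H Ψ e) (hρc : IsContinuousLaw ρ)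
    (a b : E) : AEStronglyMeasurable
      (fun V : selfAdjoint (E →L[ℂ] E) => limMean (pinch H e (V : E →L[ℂ] E)) a b) ρ := by
  refine aestronglyMeasurable_of_tendsto_ae (atTop : Filter ℕ)
    (f := fun (n : ℕ) (V : selfAdjoint (E →L[ℂ] E)) =>
      timeMean (pinch H e (V : E →L[ℂ] E)) a b n) (fun n => ?_) ?_
  · exact ((continuous_timeMean a b n).comp
      (continuous_pinch.comp continuous_subtype_val)).aestronglyMeasurable
  · filter_upwards [h.ae_hasSimpleSpectrum hρc] with V hV
    exact (hV.tendsto_timeMean a b).comp tendsto_natCast_atTop_atTop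

/-- The expectation of the time averaged transition probability for the block diagonal part of
the random operator. -/
def meanTransition (ρ : Measure (selfAdjoint (E →L[ℂ] E))) (H : E →L[ℂ] E) (e : ι → ℝ)
    (a b : E) : ℝ :=
  ∫ V : selfAdjoint (E →L[ℂ] E), limMean (pinch H e (V : E →L[ℂ] E)) a b ∂ρ

variable [IsProbabilityMeasure ρ]

lemma IsEigenbasis.integrable_limMean (h : IsEigenbasis H Ψ e) (hρc : IsContinuousLaw ρ)
    (a b : E) : Integrable
      (fun V : selfAdjoint (E →L[ℂ] E) => limMean (pinch H e (V : E →L[ℂ] E)) a b) ρ := by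
  refine Integrable.of_bound (h.aestronglyMeasurable_limMean hρc a b) (‖a‖ ^ 2 * ‖b‖ ^ 2) ?_
  filter_upwards [h.ae_hasSimpleSpectrum hρc] with V hV
  rw [Real.norm_of_nonneg (hV.limMean_nonneg a b)]
  exact hV.limMean_le a b

lemma IsEigenbasis.meanTransition_smul (h : IsEigenbasis H Ψ e) (hρc : IsContinuousLaw ρ)
    (z w : ℂ) (a b : E) :
    meanTransition ρ H e (z • a) (w • b) = ‖z‖ ^ 2 * ‖w‖ ^ 2 * meanTransition ρ H e a b := by
  rw [meanTransition, meanTransition, ← integral_const_mul]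
  refine integral_congr_ae ?_
  filter_upwards [h.ae_hasSimpleSpectrum hρc] with V hV
  exact hV.limMean_smul z w a b

lemma IsEigenbasis.two_mul_meanTransition_le (h : IsEigenbasis H Ψ e) (hρc : IsContinuousLaw ρ)
    (a b : E) : 2 * meanTransition ρ H e a b ≤
      meanTransition ρ H e a a + meanTransition ρ H e b b := by
  have hi := h.integrable_limMean hρc
  simp only [meanTransition]
  rw [← integral_const_mul, ← integral_add (hi a a) (hi b b)]
  refine integral_mono_ae ((hi a b).const_mul 2) ((hi a a).add (hi b b)) ?_
  filter_upwards [h.ae_hasSimpleSpectrum hρc] with V hV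
  exact hV.two_mul_limMean_le a b

lemma IsEigenbasis.meanTransition_parallelogram (h : IsEigenbasis H Ψ e)
    (hρc : IsContinuousLaw ρ) (a b : E) :
    meanTransition ρ H e (a + b) (a + b) + meanTransition ρ H e (a - b) (a - b) +
      (meanTransition ρ H e (a + Complex.I • b) (a + Complex.I • b) +
        meanTransition ρ H e (a - Complex.I • b) (a - Complex.I • b)) =
    4 * (meanTransition ρ H e a a + meanTransition ρ H e b b + 4 * meanTransition ρ H e a b) := by
  have hi := h.integrable_limMean hρc
  set f : E → E → selfAdjoint (E →L[ℂ] E) → ℝ := fun a b V => limMean (pinch H e (V : E →L[ℂ] E)) a b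
  have hadd : ∀ a b c d : E, ∫ V, f a b V ∂ρ + ∫ V, f c d V ∂ρ = ∫ V, (f a b V + f c d V) ∂ρ :=
    fun a b c d => (integral_add (hi a b) (hi c d)).symm
  have hi' : ∀ a b c d : E, Integrable (fun V => f a b V + f c d V) ρ :=
    fun a b c d => (hi a b).add (hi c d)
  change ∫ V, f _ _ V ∂ρ + ∫ V, f _ _ V ∂ρ + (∫ V, f _ _ V ∂ρ + ∫ V, f _ _ V ∂ρ) =
    4 * (∫ V, f _ _ V ∂ρ + ∫ V, f _ _ V ∂ρ + 4 * ∫ V, f _ _ V ∂ρ)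
  rw [hadd, hadd, hadd, ← integral_const_mul, ← integral_add (hi' _ _ _ _) (hi' _ _ _ _),
    ← integral_add (hi' _ _ _ _) ((hi _ _).const_mul 4), ← integral_const_mul]
  refine integral_congr_ae ?_
  filter_upwards [h.ae_hasSimpleSpectrum hρc] with V hV
  exact hV.limMean_parallelogram a b

lemma IsEigenbasis.sum_meanTransition (h : IsEigenbasis H Ψ e) (hρc : IsContinuousLaw ρ)
    {r : ℝ} {a : E} (ha : H a = (r : ℂ) • a) :
    ∑ K with e K = r, meanTransition ρ H e a (Ψ K) = ‖a‖ ^ 2 := by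
  simp only [meanTransition]
  rw [← integral_finsetSum _ fun K _ => h.integrable_limMean hρc a (Ψ K)]
  rw [integral_congr_ae (g := fun _ => ‖a‖ ^ 2)]
  · simp
  · filter_upwards [h.ae_hasSimpleSpectrum hρc] with V hV
    exact h.sum_limMean hV ha

lemma IsEigenbasis.meanTransition_eq_sum (h : IsEigenbasis H Ψ e) (hρc : IsContinuousLaw ρ)
    (a b : E) : meanTransition ρ H e a b =
      ∑ r ∈ Finset.univ.image e, meanTransition ρ H e (eigProj H r a) (eigProj H r b) := by
  simp only [meanTransition]
  rw [← integral_finsetSum _ fun r _ => h.integrable_limMean hρc _ _]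
  refine integral_congr_ae ?_
  filter_upwards [h.ae_hasSimpleSpectrum hρc] with V hV
  exact h.limMean_pinch_eq_sum hV a b

/-- Conjugating `V` by `U` carries the eigenbasis of the pinching along by `U`, while the law of `V`
is unchanged. -/
lemma IsEigenbasis.meanTransition_isometry (h : IsEigenbasis H Ψ e) (hρc : IsContinuousLaw ρ)
    (hρi : IsInvariantLaw H ρ) (U : E ≃ₗᵢ[ℂ] E) (hU : ∀ x, U (H x) = H (U x)) (a b : E) :
    meanTransition ρ H e (U a) (U b) = meanTransition ρ H e a b := by
  have hmap : ρ.map (conjBy (U : E →L[ℂ] E)) = ρ :=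
    hρi _ (isometry_mem_unitary U) (ContinuousLinearMap.ext hU)
  rw [meanTransition]
  conv_lhs => rw [← hmap]
  rw [integral_map (measurable_conjBy _).aemeasurable
    (by rw [hmap]; exact h.aestronglyMeasurable_limMean hρc _ _)]
  refine integral_congr_ae ?_
  filter_upwards [h.ae_hasSimpleSpectrum hρc] with V hV
  exact limMean_pinch_conjBy U hU hV a b

/-- On an eigenspace of `H`, `meanTransition ρ H e a a` depends only on the norm of `a`. -/
lemma IsEigenbasis.meanTransition_self_congr (h : IsEigenbasis H Ψ e) (hρc : IsContinuousLaw ρ)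
    (hρi : IsInvariantLaw H ρ) {r : ℝ} {a b : E} (ha : H a = (r : ℂ) • a)
    (hb : H b = (r : ℂ) • b) (hab : ‖a‖ = ‖b‖) :
    meanTransition ρ H e a a = meanTransition ρ H e b b := by
  obtain ⟨c, hc, hcab⟩ := exists_phase_reflect hab
  have hw : H (c • a - b) = (r : ℂ) • (c • a - b) := by
    rw [map_sub, map_smul, ha, hb, smul_sub, smul_comm]
  rw [← hcab, h.meanTransition_isometry hρc hρi _ (h.reflect_apply_apply hw),
    h.meanTransition_smul hρc, hc]
  simp

/-- The second moment of the overlaps with an invariant random eigenbasis. -/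
lemma IsEigenbasis.meanTransition_self (h : IsEigenbasis H Ψ e) (hρc : IsContinuousLaw ρ)
    (hρi : IsInvariantLaw H ρ) {r : ℝ} {a : E} (ha : H a = (r : ℂ) • a) :
    meanTransition ρ H e a a =
      2 / ((Finset.univ.filter fun K => e K = r).card + 1) * ‖a‖ ^ 4 := by
  classical
  by_cases h0 : a = 0
  · have := h.meanTransition_smul (ρ := ρ) hρc 0 0 0 0
    simp [h0] at this ⊢
    exact this
  obtain ⟨K₀, hK₀⟩ := h.exists_eq ha h0
  set m : ℝ := meanTransition ρ H e (Ψ K₀) (Ψ K₀) with hm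
  have hself : ∀ b : E, H b = (r : ℂ) • b → meanTransition ρ H e b b = ‖b‖ ^ 4 * m := by
    intro b hb
    rw [h.meanTransition_self_congr hρc hρi hb (b := ((‖b‖ : ℝ) : ℂ) • Ψ K₀)
      (by rw [map_smul, h K₀, hK₀, smul_comm]) (by simp [norm_smul]), h.meanTransition_smul hρc]
    simp only [Complex.norm_real, norm_norm]
    ring
  -- All four vectors `Ψ K₀ + z • Ψ K` have squared norm `2`, hence diagonal value `4 m`. The
  -- parallelogram identity reads `16 m = 4 (2 m + 4 x)`, so `x = m / 2`.
  have hoff : ∀ K, e K = r → K ≠ K₀ → meanTransition ρ H e (Ψ K₀) (Ψ K) = m / 2 := by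
    intro K hK hne
    have hpar := h.meanTransition_parallelogram hρc (Ψ K₀) (Ψ K)
    have hz : ∀ z : ℂ, ‖z‖ = 1 →
        meanTransition ρ H e (Ψ K₀ + z • Ψ K) (Ψ K₀ + z • Ψ K) = 4 * m := by
      intro z hz
      rw [hself]
      · have : ‖Ψ K₀ + z • Ψ K‖ ^ 2 = 2 := by
          have h1 := norm_add_sq_eq_norm_sq_add_norm_sq_of_inner_eq_zero (𝕜 := ℂ) (Ψ K₀) (z • Ψ K)
            (by rw [inner_smul_right, Ψ.inner_eq_zero hne.symm, mul_zero])
          rw [norm_smul, Ψ.norm_eq_one, Ψ.norm_eq_one, hz] at h1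
          rw [sq, h1]
          norm_num
        rw [show (4 : ℕ) = 2 * 2 by norm_num, pow_mul, this]
        norm_num
      · rw [map_add, map_smul, h K₀, h K, hK₀, hK, smul_add, smul_comm]
    have h1 := hz 1 (by simp)
    have h2 := hz (-1) (by simp)
    have h3 := hz Complex.I (by simp)
    have h4 := hz (-Complex.I) (by simp)
    have h5 := hself (Ψ K) (by rw [h K, hK])
    rw [Ψ.norm_eq_one] at h5
    simp only [one_smul, neg_smul, ← sub_eq_add_neg] at h1 h2 h3 h4
    rw [h1, h2, h3, h4, h5, ← hm] at hpar
    linarith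
  -- Transition probabilities within the eigenspace sum to `1`: `m + (D - 1) m / 2 = 1`, which gives
  -- `m = 2 / (D + 1)`.
  have hsum := h.sum_meanTransition (ρ := ρ) hρc (a := Ψ K₀) (by rw [h K₀, hK₀])
  have hmem : K₀ ∈ Finset.univ.filter fun K => e K = r := by simp [hK₀]
  rw [← Finset.add_sum_erase _ _ hmem, Finset.sum_congr rfl fun K hK => hoff K
    (Finset.mem_filter.1 (Finset.mem_of_mem_erase hK)).2 (Finset.ne_of_mem_erase hK),
    Finset.sum_const, Finset.card_erase_of_mem hmem, nsmul_eq_mul, Ψ.norm_eq_one,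
    Nat.cast_sub (Finset.card_pos.2 ⟨_, hmem⟩), ← hm] at hsum
  have hm' : m = 2 / ((Finset.univ.filter fun K => e K = r).card + 1) := by
    rw [eq_div_iff (by positivity)]
    push_cast at hsum
    linarith
  rw [hself a ha, hm', mul_comm]

lemma IsEigenbasis.meanTransition_le (h : IsEigenbasis H Ψ e) (hρc : IsContinuousLaw ρ)
    (hρi : IsInvariantLaw H ρ) {r : ℝ} {a b : E} (ha : H a = (r : ℂ) • a)
    (hb : H b = (r : ℂ) • b) :
    meanTransition ρ H e a b ≤
      2 / ((Finset.univ.filter fun K => e K = r).card + 1) * (‖a‖ ^ 2 * ‖b‖ ^ 2) := by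
  by_cases h0 : a = 0 ∨ b = 0
  · have : meanTransition ρ H e a b = 0 := by
      rcases h0 with h0 | h0
      · have := h.meanTransition_smul (ρ := ρ) hρc 0 1 0 b
        simpa [h0] using this
      · have := h.meanTransition_smul (ρ := ρ) hρc 1 0 a 0
        simpa [h0] using this
    rw [this]
    positivity
  · push Not at h0
    -- Rescaling to `‖b‖ a` and `‖a‖ b` equalizes the norms, so the arithmetic-geometric inequality
    -- produces the product of norms.
    have h1 := h.two_mul_meanTransition_le (ρ := ρ) hρc (((‖b‖ : ℝ) : ℂ) • a) (((‖a‖ : ℝ) : ℂ) • b)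
    rw [h.meanTransition_smul hρc, h.meanTransition_smul hρc, h.meanTransition_smul hρc,
      h.meanTransition_self hρc hρi ha, h.meanTransition_self hρc hρi hb] at h1
    simp only [Complex.norm_real, norm_norm] at h1
    have hab : 0 < ‖a‖ ^ 2 * ‖b‖ ^ 2 := by
      have := norm_pos_iff.2 h0.1
      have := norm_pos_iff.2 h0.2
      positivity
    refine le_of_mul_le_mul_left ?_ (mul_pos two_pos hab)
    linarith

/-- If the vectors `p j` have small overlap with each eigenvector `Ψ K`, then they have small
mean transition probabilities. -/
theorem IsEigenbasis.sum_meanTransition_le (h : IsEigenbasis H Ψ e) (hρc : IsContinuousLaw ρ)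
    (hρi : IsInvariantLaw H ρ) {J κ : Type*} [Fintype J] [Fintype κ] (p : J → E) (u : κ → E)
    {ε : ℝ} (hp : ∀ K, ∑ j, ‖(inner ℂ (Ψ K) (p j) : ℂ)‖ ^ 2 ≤ ε) :
    ∑ j, ∑ k, meanTransition ρ H e (p j) (u k) ≤ 2 * ε * ∑ k, ‖u k‖ ^ 2 := by
  set D : ℝ → ℕ := fun r => (Finset.univ.filter fun K => e K = r).card with hD
  have h1 : ∀ j k, meanTransition ρ H e (p j) (u k) ≤ ∑ r ∈ Finset.univ.image e,
      2 / ((D r : ℝ) + 1) * (‖eigProj H r (p j)‖ ^ 2 * ‖eigProj H r (u k)‖ ^ 2) := by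
    intro j k
    rw [h.meanTransition_eq_sum hρc]
    exact Finset.sum_le_sum fun r _ =>
      h.meanTransition_le hρc hρi (apply_eigProj r _) (apply_eigProj r _)
  -- A trace over the eigenspace: each of its `D r` basis vectors contributes at most `ε`. This
  -- factor cancels against `2 / (D r + 1)`.
  have hpos : ∀ r ∈ Finset.univ.image e, ∑ j, ‖eigProj H r (p j)‖ ^ 2 ≤ D r * ε := by
    intro r _
    simp_rw [h.norm_sq_eigProj]
    rw [Finset.sum_comm, hD, ← nsmul_eq_mul]
    exact Finset.sum_le_card_nsmul _ _ _ fun K _ => hp K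
  calc ∑ j, ∑ k, meanTransition ρ H e (p j) (u k)
      ≤ ∑ j, ∑ k, ∑ r ∈ Finset.univ.image e,
        2 / ((D r : ℝ) + 1) * (‖eigProj H r (p j)‖ ^ 2 * ‖eigProj H r (u k)‖ ^ 2) :=
        Finset.sum_le_sum fun j _ => Finset.sum_le_sum fun k _ => h1 j k
    _ = ∑ r ∈ Finset.univ.image e, ∑ k,
        2 / ((D r : ℝ) + 1) * ((∑ j, ‖eigProj H r (p j)‖ ^ 2) * ‖eigProj H r (u k)‖ ^ 2) := by
        rw [Finset.sum_congr rfl fun j _ => Finset.sum_comm, Finset.sum_comm]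
        refine Finset.sum_congr rfl fun r _ => ?_
        rw [Finset.sum_comm]
        refine Finset.sum_congr rfl fun k _ => ?_
        rw [Finset.sum_mul, Finset.mul_sum]
    _ ≤ ∑ r ∈ Finset.univ.image e, ∑ k, 2 * ε * ‖eigProj H r (u k)‖ ^ 2 := by
        refine Finset.sum_le_sum fun r hr => Finset.sum_le_sum fun k _ => ?_
        rw [← mul_assoc]
        refine mul_le_mul_of_nonneg_right ?_ (by positivity)
        obtain ⟨K, -, rfl⟩ := Finset.mem_image.1 hr
        have hε : 0 ≤ ε := (Finset.sum_nonneg fun j _ => by positivity).trans (hp K)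
        calc 2 / ((D (e K) : ℝ) + 1) * ∑ j, ‖eigProj H (e K) (p j)‖ ^ 2
            ≤ 2 / ((D (e K) : ℝ) + 1) * (D (e K) * ε) := by
              gcongr
              exact hpos _ hr
          _ = 2 * ε * (D (e K) / ((D (e K) : ℝ) + 1)) := by ring
          _ ≤ 2 * ε * 1 := by
              gcongr
              rw [div_le_one (by positivity)]
              linarith
          _ = 2 * ε := mul_one _
    _ = 2 * ε * ∑ k, ‖u k‖ ^ 2 := by
        rw [Finset.sum_comm, Finset.mul_sum]
        refine Finset.sum_congr rfl fun k _ => ?_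
        rw [← Finset.mul_sum, h.sum_norm_sq_eigProj]

end Invariance

section Abstract

variable {E : Type*} [NormedAddCommGroup E] [InnerProductSpace ℂ E] [FiniteDimensional ℂ E]
  [CompleteSpace E] {ι : Type*} [Fintype ι] {H : E →L[ℂ] E} {Ψ : OrthonormalBasis ι ℂ E} {e : ι → ℝ}

/-! ### Most initial states -/

lemma HasSimpleSpectrum.tendsto_mean_norm_sq {A : E →L[ℂ] E} (hA : HasSimpleSpectrum A)
    {P : E →L[ℂ] E} {J : Type*} [Fintype J] {p : J → E}
    (hp : ∀ x, ‖P x‖ ^ 2 = ∑ j, ‖(inner ℂ (p j) x : ℂ)‖ ^ 2) (ψ : E) :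
    Tendsto (fun T : ℝ => T⁻¹ * ∫ t in (0 : ℝ)..T, ‖P (evolve A t ψ)‖ ^ 2) atTop
      (𝓝 (∑ j, limMean A (p j) ψ)) := by
  refine (tendsto_finsetSum _ fun j _ => hA.tendsto_timeMean (p j) ψ).congr fun T => ?_
  simp only [timeMean]
  rw [← Finset.mul_sum, ← intervalIntegral.integral_finsetSum]
  · simp_rw [hp]
  · intro j _
    exact (((continuous_const.inner (continuous_evolve_apply A ψ)).norm).pow 2).intervalIntegrable _ _

lemma HasSimpleSpectrum.continuous_limMean {A : E →L[ℂ] E} (hA : HasSimpleSpectrum A) (a : E) :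
    Continuous (limMean A a) := by
  obtain ⟨φ, u, h, hu⟩ := hA
  have : limMean A a = fun b => ∑ n, ‖(inner ℂ a (φ n) : ℂ)‖ ^ 2 * ‖(inner ℂ b (φ n) : ℂ)‖ ^ 2 :=
    funext fun b => h.limMean_eq hu a b
  rw [this]
  fun_prop

lemma HasSimpleSpectrum.integral_limMean [MeasurableSpace E] [BorelSpace E] {A : E →L[ℂ] E}
    (hA : HasSimpleSpectrum A) {K : Submodule ℂ E} (hK : K ≠ ⊥) {κ : Type*} [Fintype κ]
    (u : OrthonormalBasis κ ℂ K) (a : E) :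
    ∫ ψ, limMean A a (ψ.1 : E) ∂uniformSphere K =
      (Fintype.card κ : ℝ)⁻¹ * ∑ k, limMean A a (u k) := by
  have := isProbabilityMeasure_uniformSphere hK
  obtain ⟨φ, v, h, hv⟩ := hA
  simp only [h.limMean_eq hv]
  have hint : ∀ b : E, Integrable (fun ψ : Metric.sphere (0 : K) 1 =>
      ‖(inner ℂ (ψ.1 : E) b : ℂ)‖ ^ 2) (uniformSphere K) := by
    intro b
    refine Integrable.of_bound (Continuous.aestronglyMeasurable (by fun_prop)) (‖b‖ ^ 2)
      (ae_of_all _ fun ψ => ?_)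
    rw [Real.norm_of_nonneg (by positivity)]
    gcongr
    have := norm_inner_le_norm (𝕜 := ℂ) (ψ.1 : E) b
    rwa [show ‖(ψ.1 : E)‖ = 1 from norm_eq_of_mem_sphere ψ, one_mul] at this
  rw [integral_finsetSum _ fun n _ => (hint _).const_mul _, Finset.sum_comm, Finset.mul_sum]
  refine Finset.sum_congr rfl fun n _ => ?_
  rw [integral_const_mul, ← Finset.mul_sum]
  have := integral_uniformSphere_inner hK u (φ n)
  simp_rw [norm_inner_symm (φ n)] at this
  rw [this]
  ring

/-- Two applications of Markov's inequality: over the sphere to the time average `F`, with threshold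
`δ' c`, and then over time. The sphere average of `F` is `1 / dim K` times its sum over an
orthonormal basis of `K`. -/
lemma HasSimpleSpectrum.forMost [MeasurableSpace E] [BorelSpace E] {A : E →L[ℂ] E}
    (hA : HasSimpleSpectrum A) {K : Submodule ℂ E} (hK : K ≠ ⊥) {κ : Type*} [Fintype κ]
    (u : OrthonormalBasis κ ℂ K) {P : E →L[ℂ] E} {J : Type*} [Fintype J] {p : J → E}
    (hp : ∀ x, ‖P x‖ ^ 2 = ∑ j, ‖(inner ℂ (p j) x : ℂ)‖ ^ 2) {δ δ' c : ℝ} (hδ' : 0 < δ')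
    (hc : 0 < c)
    (hG : (Fintype.card κ : ℝ)⁻¹ * ∑ j, ∑ k, limMean A (p j) (u k) ≤ δ * (δ' * c)) :
    ForMost (uniformSphere K) δ fun ψ =>
      ForMostTimes δ' fun t => ‖P (evolve A t (ψ.1 : E))‖ ^ 2 < c := by
  have := isProbabilityMeasure_uniformSphere hK
  set F : Metric.sphere (0 : K) 1 → ℝ := fun ψ => ∑ j, limMean A (p j) (ψ.1 : E) with hF
  have hFc : Continuous F := continuous_finsetSum _ fun j _ =>
    (hA.continuous_limMean (p j)).comp (continuous_subtype_val.comp continuous_subtype_val)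
  have hint : ∀ j, Integrable (fun ψ : Metric.sphere (0 : K) 1 => limMean A (p j) (ψ.1 : E))
      (uniformSphere K) := by
    intro j
    refine Integrable.of_bound ((hA.continuous_limMean (p j)).comp
      (continuous_subtype_val.comp continuous_subtype_val)).aestronglyMeasurable (‖p j‖ ^ 2)
      (ae_of_all _ fun ψ => ?_)
    rw [Real.norm_of_nonneg (hA.limMean_nonneg _ _)]
    have := hA.limMean_le (p j) (ψ.1 : E)
    rwa [show ‖(ψ.1 : E)‖ = 1 from norm_eq_of_mem_sphere ψ, one_pow, mul_one] at this
  have hFint : Integrable F (uniformSphere K) := integrable_finsetSum _ fun j _ => hint j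
  have hF0 : ∀ ψ, 0 ≤ F ψ := fun ψ => Finset.sum_nonneg fun j _ => hA.limMean_nonneg _ _
  have hmean : ∫ ψ, F ψ ∂uniformSphere K =
      (Fintype.card κ : ℝ)⁻¹ * ∑ j, ∑ k, limMean A (p j) (u k) := by
    rw [hF, integral_finsetSum _ fun j _ => hint j, Finset.mul_sum]
    exact Finset.sum_congr rfl fun j _ => hA.integral_limMean hK u (p j)
  have hmarkov := mul_meas_ge_le_integral_of_nonneg (ae_of_all _ hF0) hFint (δ' * c)
  have hbad : (uniformSphere K).real {ψ | δ' * c ≤ F ψ} ≤ δ := by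
    have h1 := hmarkov.trans (hmean.le.trans hG)
    rw [mul_comm δ] at h1
    exact le_of_mul_le_mul_left h1 (by positivity)
  have hmeas : MeasurableSet {ψ | δ' * c ≤ F ψ} := measurableSet_le measurable_const hFc.measurable
  refine ⟨{ψ | δ' * c ≤ F ψ}ᶜ, hmeas.compl, fun ψ hψ => ?_, ?_⟩
  · have hψ' : F ψ ≤ δ' * c := (lt_of_not_ge fun h1 => hψ h1).le
    refine forMostTimes_of_tendsto ?_ (fun t => by positivity)
      (hA.tendsto_mean_norm_sq hp (ψ.1 : E)) hc hψ'
    exact ((P.continuous.comp (continuous_evolve_apply A _)).norm).pow 2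
  · rw [← ofReal_measureReal, probReal_compl_eq_one_sub hmeas]
    exact ENNReal.ofReal_le_ofReal (by linarith)

/-! ### Most perturbations -/

lemma HasSimpleSpectrum.smul {A : E →L[ℂ] E} (hA : HasSimpleSpectrum A) {c : ℝ} (hc : c ≠ 0) :
    HasSimpleSpectrum ((c : ℂ) • A) := by
  obtain ⟨φ, u, h, hu⟩ := hA
  refine ⟨φ, fun n => c * u n, fun n => ?_, fun n m hnm => hu (mul_left_cancel₀ hc hnm)⟩
  rw [smul_apply, h n, smul_smul]
  push_cast
  rfl

/-- With `H = 0` there is a single block, and the pinching of `V` is `V` itself. -/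
lemma ae_hasSimpleSpectrum_selfAdjoint :
    ∀ᵐ V : selfAdjoint (E →L[ℂ] E) ∂Measure.addHaar, HasSimpleSpectrum (V : E →L[ℂ] E) := by
  have h0 : IsEigenbasis (0 : E →L[ℂ] E) (stdOrthonormalBasis ℂ E) (fun _ => 0) :=
    fun n => by simp
  filter_upwards [h0.ae_hasSimpleSpectrum_pinch] with V hV
  convert! hV using 1
  refine ContinuousLinearMap.ext fun x => ?_
  rw [h0.pinch_apply (V : E →L[ℂ] E) (r := 0) (by simp)]
  exact (eigProj_eq_self_iff.2 (by simp)).symm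

/-- `H + lam V = lam (V + H / lam)`, and Lebesgue measure is invariant under the translation by `H /
lam`. -/
lemma IsEigenbasis.ae_hasSimpleSpectrum_perturb (h : IsEigenbasis H Ψ e)
    {ρ : Measure (selfAdjoint (E →L[ℂ] E))} (hρc : IsContinuousLaw ρ) {lam : ℝ} (hlam : lam ≠ 0) :
    ∀ᵐ V : selfAdjoint (E →L[ℂ] E) ∂ρ, HasSimpleSpectrum (H + (lam : ℂ) • (V : E →L[ℂ] E)) := by
  set H' : selfAdjoint (E →L[ℂ] E) := lam⁻¹ • ⟨H, h.isSelfAdjoint⟩ with hH'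
  have h1 := (measurePreserving_add_right (Measure.addHaar : Measure (selfAdjoint (E →L[ℂ] E)))
    H').quasiMeasurePreserving.ae ae_hasSimpleSpectrum_selfAdjoint
  refine hρc.ae_le ?_
  filter_upwards [h1] with V hV
  have h2 : H + (lam : ℂ) • (V : E →L[ℂ] E) = (lam : ℂ) • ((V + H' : selfAdjoint (E →L[ℂ] E)) :
      E →L[ℂ] E) := by
    have h3 : ((H' : selfAdjoint (E →L[ℂ] E)) : E →L[ℂ] E) = ((lam : ℂ)⁻¹) • H := by
      change lam⁻¹ • H = _
      rw [RCLike.real_smul_eq_coe_smul (K := ℂ)]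
      simp
    rw [AddSubgroup.coe_add, h3, smul_add, smul_smul, mul_inv_cancel₀ (by exact_mod_cast hlam),
      one_smul, add_comm]
  rw [h2]
  exact hV.smul hlam

/-- Thermalization after a generic small perturbation: if each vector of an orthonormal eigenbasis
of `H` has little weight in the range of `P`, then this holds for most perturbations, most initial
states and most times. -/
theorem IsEigenbasis.thermalization [MeasurableSpace E] [BorelSpace E] (h : IsEigenbasis H Ψ e)
    {ρ : Measure (selfAdjoint (E →L[ℂ] E))} [IsProbabilityMeasure ρ] (hρc : IsContinuousLaw ρ)
    (hρi : IsInvariantLaw H ρ) {K : Submodule ℂ E} (hK : K ≠ ⊥) {P : E →L[ℂ] E} {ε : ℝ}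
    (hε : 0 < ε) (hP : ∀ n, ‖P (Ψ n)‖ ^ 2 ≤ ε) {δ δ' δ'' : ℝ} (hδ : 0 < δ) (hδ' : 0 < δ')
    (hδ'' : 0 < δ'') :
    ∃ lam₀ : ℝ, 0 < lam₀ ∧ ∀ lam ∈ Ioo 0 lam₀, ForMost ρ δ fun V =>
      ForMost (uniformSphere K) δ' fun ψ => ForMostTimes δ'' fun t =>
        ‖P (evolve (H + (lam : ℂ) • (V : E →L[ℂ] E)) t (ψ.1 : E))‖ ^ 2 <
          3 / (δ * δ' * δ'') * ε := by
  set φ := stdOrthonormalBasis ℂ E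
  set u := stdOrthonormalBasis ℂ K
  set p : Fin (Module.finrank ℂ E) → E := fun j => ContinuousLinearMap.adjoint P (φ j) with hp
  have hpP : ∀ x, ‖P x‖ ^ 2 = ∑ j, ‖(inner ℂ (p j) x : ℂ)‖ ^ 2 := by
    intro x
    simp only [hp, ContinuousLinearMap.adjoint_inner_left]
    exact (φ.sum_sq_norm_inner_right _).symm
  have hdim : 0 < (Module.finrank ℂ K : ℝ) := by
    have : Nontrivial K := Submodule.nontrivial_iff_ne_bot.2 hK
    exact_mod_cast Module.finrank_pos
  set G : (E →L[ℂ] E) → ℝ := fun A =>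
    (Fintype.card (Fin (Module.finrank ℂ K)) : ℝ)⁻¹ * ∑ j, ∑ k, limMean A (p j) (u k) with hG
  set c : ℝ := 3 / (δ * δ' * δ'') * ε with hc
  have hc0 : 0 < c := by positivity
  set S : ℝ → Set (selfAdjoint (E →L[ℂ] E)) := fun lam =>
    {V | HasSimpleSpectrum (H + (lam : ℂ) • (V : E →L[ℂ] E)) ∧
      G (H + (lam : ℂ) • (V : E →L[ℂ] E)) ≤ 3 * ε / δ} with hS
  have hgood : ∀ lam V, V ∈ S lam → ForMost (uniformSphere K) δ' fun ψ => ForMostTimes δ'' fun t =>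
      ‖P (evolve (H + (lam : ℂ) • (V : E →L[ℂ] E)) t (ψ.1 : E))‖ ^ 2 < c := by
    rintro lam V ⟨hV, hGV⟩
    refine hV.forMost hK u hpP hδ'' hc0 (hGV.trans (le_of_eq ?_))
    rw [hc]
    field_simp
  -- the limit distribution
  set X : selfAdjoint (E →L[ℂ] E) → ℝ := fun V => G (pinch H e (V : E →L[ℂ] E)) with hX
  have hint : ∀ a b, Integrable
      (fun V : selfAdjoint (E →L[ℂ] E) => limMean (pinch H e (V : E →L[ℂ] E)) a b) ρ :=
    h.integrable_limMean hρc
  have hXint : Integrable X ρ := (integrable_finsetSum _ fun j _ =>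
    integrable_finsetSum _ fun k _ => hint _ _).const_mul _
  have hX0 : 0 ≤ᵐ[ρ] X := by
    filter_upwards [h.ae_hasSimpleSpectrum hρc] with V hV
    exact mul_nonneg (by positivity)
      (Finset.sum_nonneg fun j _ => Finset.sum_nonneg fun k _ => hV.limMean_nonneg _ _)
  have hXmean : ∫ V, X V ∂ρ ≤ 2 * ε := by
    have h1 : ∫ V, X V ∂ρ = (Fintype.card (Fin (Module.finrank ℂ K)) : ℝ)⁻¹ *
        ∑ j, ∑ k, meanTransition ρ H e (p j) (u k) := by
      simp only [hX, hG]
      rw [integral_const_mul, integral_finsetSum _ fun j _ => integrable_finsetSum _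
        fun k _ => hint _ _]
      congr 1
      refine Finset.sum_congr rfl fun j _ => ?_
      rw [integral_finsetSum _ fun k _ => hint _ _]
      rfl
    have h2 := h.sum_meanTransition_le hρc hρi p (fun k => (u k : E)) (ε := ε) (fun n => by
      simp_rw [norm_inner_symm (Ψ n)]
      rw [← hpP]
      exact hP n)
    have h3 : ∑ k, ‖(u k : E)‖ ^ 2 = (Module.finrank ℂ K : ℝ) := by
      have : ∀ k, ‖(u k : E)‖ = 1 := fun k => u.norm_eq_one k
      simp [this]
    rw [h3] at h2
    rw [h1, Fintype.card_fin]
    refine (mul_le_mul_of_nonneg_left h2 (by positivity)).trans (le_of_eq ?_)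
    field_simp
  -- The threshold `5ε / (2δ)` lies between what the mean bound `2ε` requires and the target `3ε /
  -- δ`. It leaves room twice: the exceptional probability is at most `4δ/5 < δ`, and `X V < 3ε / δ`
  -- is strict, hence stable for small `lam`.
  have hmarkov := mul_meas_ge_le_integral_of_nonneg hX0 hXint (5 / 2 * ε / δ)
  have hbad : ρ.real {V | 5 / 2 * ε / δ ≤ X V} ≤ 4 / 5 * δ := by
    refine le_of_mul_le_mul_left ((hmarkov.trans hXmean).trans (le_of_eq ?_))
      (by positivity : 0 < 5 / 2 * ε / δ)
    field_simp
    norm_num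
  -- sets of perturbations that are good for all small `lam`
  set A : ℕ → Set (selfAdjoint (E →L[ℂ] E)) := fun m =>
    {V | ∀ lam ∈ Ioo (0 : ℝ) (1 / ((m : ℝ) + 1)), V ∈ S lam} with hA
  have hAmono : Monotone A := by
    intro m n hmn V hV lam hlam
    exact hV lam ⟨hlam.1, hlam.2.trans_le (Nat.one_div_le_one_div hmn)⟩
  have hcover : ∀ᵐ V ∂ρ, V ∈ {V | 5 / 2 * ε / δ ≤ X V}ᶜ → V ∈ ⋃ m, A m := by
    filter_upwards [h.ae_hasSimpleSpectrum hρc] with V hV hVX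
    have h1 : X V < 3 * ε / δ := by
      refine (lt_of_not_ge fun h1 => hVX h1).trans ?_
      gcongr
      norm_num
    have hlim : Tendsto (fun lam : ℝ => G (H + (lam : ℂ) • (V : E →L[ℂ] E))) (𝓝[>] 0)
        (𝓝 (X V)) :=
      (tendsto_finsetSum _ fun j _ => tendsto_finsetSum _ fun k _ =>
        h.tendsto_limMean V.2 hV _ _).const_mul _
    have hev : ∀ᶠ lam : ℝ in 𝓝[>] 0, V ∈ S lam := by
      filter_upwards [h.eventually_hasSimpleSpectrum V.2 hV, hlim.eventually_lt_const h1]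
        with lam h2 h3
      exact ⟨h2, h3.le⟩
    obtain ⟨r, hr, hsub⟩ := mem_nhdsGT_iff_exists_Ioo_subset.1 hev
    obtain ⟨m, hm⟩ := exists_nat_one_div_lt (show (0 : ℝ) < r from hr)
    exact mem_iUnion.2 ⟨m, fun lam hlam => hsub ⟨hlam.1, hlam.2.trans hm⟩⟩
  -- `limMean` is controlled only where the spectrum is simple, so `S lam` is measurable up to null
  -- sets; `ForMost` is later given a measurable subset of full measure.
  have hnull : ∀ lam : ℝ, lam ≠ 0 → NullMeasurableSet (S lam) ρ := by
    intro lam hlam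
    have hsimple := h.ae_hasSimpleSpectrum_perturb hρc hlam
    have hmeas : ∀ a b, AEMeasurable
        (fun V : selfAdjoint (E →L[ℂ] E) => limMean (H + (lam : ℂ) • (V : E →L[ℂ] E)) a b) ρ := by
      intro a b
      refine aemeasurable_of_tendsto_metrizable_ae (atTop : Filter ℕ)
        (f := fun (n : ℕ) (V : selfAdjoint (E →L[ℂ] E)) =>
          timeMean (H + (lam : ℂ) • (V : E →L[ℂ] E)) a b n) (fun n => ?_) ?_
      · exact ((continuous_timeMean a b n).comp (by fun_prop)).measurable.aemeasurable
      · filter_upwards [hsimple] with V hV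
        exact (hV.tendsto_timeMean a b).comp tendsto_natCast_atTop_atTop
    have hGmeas : AEMeasurable
        (fun V : selfAdjoint (E →L[ℂ] E) => G (H + (lam : ℂ) • (V : E →L[ℂ] E))) ρ :=
      (Finset.aemeasurable_fun_sum _ fun j _ =>
        Finset.aemeasurable_fun_sum _ fun k _ => hmeas _ _).const_mul _
    refine (nullMeasurableSet_le hGmeas (aemeasurable_const (b := 3 * ε / δ))).congr ?_
    filter_upwards [hsimple] with V hV
    exact propext ⟨fun h1 => ⟨hV, h1⟩, fun h1 => h1.2⟩
  rcases le_or_gt 1 δ with hδ1 | hδ1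
  · refine ⟨1, one_pos, fun lam _ => ⟨∅, MeasurableSet.empty, empty_subset _, ?_⟩⟩
    rw [ENNReal.ofReal_of_nonpos (by linarith)]
    exact zero_le
  have hlt : ENNReal.ofReal (1 - δ) < ρ (⋃ m, A m) := by
    have hnm : NullMeasurableSet {V | 5 / 2 * ε / δ ≤ X V} ρ :=
      nullMeasurableSet_le aemeasurable_const hXint.aemeasurable
    calc ENNReal.ofReal (1 - δ) < ENNReal.ofReal (1 - 4 / 5 * δ) := by
          rw [ENNReal.ofReal_lt_ofReal_iff (by linarith)]
          linarith
      _ ≤ ρ {V | 5 / 2 * ε / δ ≤ X V}ᶜ := by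
          rw [← ofReal_measureReal, probReal_compl_eq_one_sub₀ hnm]
          exact ENNReal.ofReal_le_ofReal (by linarith)
      _ ≤ ρ (⋃ m, A m) := measure_mono_ae hcover
  -- The threshold `lam₀` must not depend on `V`. Continuity from below along the increasing sets `A
  -- m`, together with the strict inequality, selects one `m`.
  rw [hAmono.measure_iUnion, lt_iSup_iff] at hlt
  obtain ⟨m, hm⟩ := hlt
  refine ⟨1 / ((m : ℝ) + 1), by positivity, fun lam hlam => ?_⟩
  obtain ⟨B, hBsub, hBmeas, hBae⟩ := (hnull lam hlam.1.ne').exists_measurable_subset_ae_eq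
  refine ⟨B, hBmeas, fun V hV => hgood lam V (hBsub hV), ?_⟩
  rw [measure_congr hBae]
  exact hm.le.trans (measure_mono fun V hV => hV lam hlam)

end Abstract

section Fermions

variable {d L : ℕ}

/-! ### Canonical anticommutation relations -/

lemma fermiSign_mul_self (x : Site d L) (S : Finset (Site d L)) :
    fermiSign x S * fermiSign x S = 1 := by
  rw [fermiSign, ← mul_pow]
  norm_num

lemma conj_fermiSign (x : Site d L) (S : Finset (Site d L)) :
    (starRingEnd ℂ) (fermiSign x S) = fermiSign x S := by
  simp [fermiSign]

open scoped Classical in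
/-- The sign picked up when the order of two sites is exchanged. -/
def swapSign (z x : Site d L) : ℂ := if toLex z < toLex x then -1 else 1

lemma fermiSign_insert {x z : Site d L} {S : Finset (Site d L)} (hz : z ∉ S) :
    fermiSign x (insert z S) = swapSign z x * fermiSign x S := by
  rw [fermiSign, fermiSign, swapSign]
  split_ifs with h
  · have : {y : Site d L | y ∈ insert z S ∧ toLex y < toLex x} =
        insert z {y : Site d L | y ∈ S ∧ toLex y < toLex x} := by
      ext y
      simp only [Finset.mem_insert, Set.mem_ofPred_eq, Set.mem_insert_iff]
      constructor
      · rintro ⟨rfl | h1, h2⟩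
        · exact Or.inl rfl
        · exact Or.inr ⟨h1, h2⟩
      · rintro (rfl | h1)
        · exact ⟨Or.inl rfl, h⟩
        · exact ⟨Or.inr h1.1, h1.2⟩
    rw [this, Set.ncard_insert_of_notMem (fun h1 => hz h1.1) (Set.toFinite _), pow_succ]
    ring
  · have : {y : Site d L | y ∈ insert z S ∧ toLex y < toLex x} =
        {y : Site d L | y ∈ S ∧ toLex y < toLex x} := by
      ext y
      simp only [Finset.mem_insert, Set.mem_ofPred_eq]
      constructor
      · rintro ⟨rfl | h1, h2⟩
        · exact absurd h2 h
        · exact ⟨h1, h2⟩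
      · exact fun h1 => ⟨Or.inr h1.1, h1.2⟩
    rw [this, one_mul]

lemma fermiSign_erase {x z : Site d L} {S : Finset (Site d L)} (hz : z ∈ S) :
    fermiSign x S = swapSign z x * fermiSign x (S.erase z) := by
  rw [← fermiSign_insert (Finset.notMem_erase z S), Finset.insert_erase hz]

lemma create_apply (x : Site d L) (ψ : Fock d L) (S : Finset (Site d L)) :
    create x ψ S = if x ∈ S then fermiSign x (S.erase x) * ψ (S.erase x) else 0 := by
  have h1 : create x ψ S = inner ℂ (EuclideanSpace.single S (1 : ℂ)) (create x ψ) := by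
    simp [EuclideanSpace.inner_single_left]
  rw [h1, create, ContinuousLinearMap.adjoint_inner_right, PiLp.inner_apply]
  have h2 : ∀ T, inner ℂ (annihilate x (EuclideanSpace.single S (1 : ℂ)) T) (ψ T) =
      if x ∉ T ∧ insert x T = S then fermiSign x T * ψ T else 0 := by
    intro T
    rw [annihilate_apply]
    by_cases hx : x ∈ T
    · simp [hx]
    · by_cases hT : insert x T = S
      · simp [hx, hT, conj_fermiSign, mul_comm]
      · simp [hx, hT]
  simp_rw [h2]
  split_ifs with hx
  · rw [Finset.sum_eq_single (S.erase x)]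
    · simp [Finset.insert_erase hx]
    · intro T _ hT
      rw [if_neg]
      rintro ⟨h3, rfl⟩
      exact hT (Finset.erase_insert h3).symm
    · simp
  · refine Finset.sum_eq_zero fun T _ => if_neg ?_
    rintro ⟨h3, rfl⟩
    exact hx (Finset.mem_insert_self x T)

lemma swapSign_add {x y : Site d L} (hxy : x ≠ y) : swapSign x y + swapSign y x = 0 := by
  rw [swapSign, swapSign]
  rcases lt_or_gt_of_ne (fun h => hxy (toLex.injective h) : toLex x ≠ toLex y) with h | h
  · have h1 : toLex x < toLex y := h
    have h2 : ¬ toLex y < toLex x := h.le.not_gt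
    rw [if_pos h1, if_neg h2, neg_add_cancel]
  · have h1 : toLex y < toLex x := h
    have h2 : ¬ toLex x < toLex y := h.le.not_gt
    rw [if_pos h1, if_neg h2, add_neg_cancel]

lemma swapSign_mul {x y : Site d L} (hxy : x ≠ y) : swapSign x y * swapSign y x = -1 := by
  have h : swapSign x y * swapSign x y = 1 := by
    rw [swapSign]
    split_ifs <;> simp
  linear_combination swapSign x y * swapSign_add hxy - h

/-- The canonical anticommutation relation. For `x ≠ y` the two orders differ by `swapSign x y *
swapSign y x = -1`, since exactly one of the sites precedes the other. -/
lemma annihilate_create (x y : Site d L) (ψ : Fock d L) :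
    annihilate y (create x ψ) = (if x = y then ψ else 0) - create x (annihilate y ψ) := by
  ext S
  rw [PiLp.sub_apply, create_apply, annihilate_apply, annihilate_apply, create_apply]
  by_cases hxy : x = y
  · subst hxy
    by_cases hx : x ∈ S
    · simp only [hx, if_true, Finset.notMem_erase, if_false, Finset.insert_erase hx,
        ← mul_assoc, fermiSign_mul_self, one_mul, sub_self]
    · simp only [hx, if_false, if_true, Finset.mem_insert_self, Finset.erase_insert hx,
        ← mul_assoc, fermiSign_mul_self, one_mul, sub_zero]
  · by_cases hy : y ∈ S
    · have : y ∈ S.erase x := Finset.mem_erase.2 ⟨fun h => hxy h.symm, hy⟩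
      simp [hy, hxy, this]
    · by_cases hx : x ∈ S
      · have hy' : y ∉ S.erase x := fun h => hy (Finset.mem_of_mem_erase h)
        have he : (insert y S).erase x = insert y (S.erase x) :=
          Finset.erase_insert_of_ne (fun h => hxy h.symm)
        simp only [hy, hx, hxy, hy', if_true, if_false, Finset.mem_insert, or_true, he,
          PiLp.zero_apply]
        rw [fermiSign_insert hy', fermiSign_erase (x := y) hx]
        linear_combination (fermiSign y (S.erase x) * fermiSign x (S.erase x) *
          ψ (insert y (S.erase x))) * swapSign_mul hxy
      · simp [hy, hx, hxy]

lemma create_create (x y : Site d L) (ψ : Fock d L) :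
    create x (create y ψ) = -create y (create x ψ) := by
  ext S
  rw [PiLp.neg_apply, create_apply, create_apply, create_apply, create_apply]
  by_cases hxy : x = y
  · subst hxy
    simp
  · by_cases hx : x ∈ S
    · by_cases hy : y ∈ S
      · have hx' : x ∈ S.erase y := Finset.mem_erase.2 ⟨hxy, hx⟩
        have hy' : y ∈ S.erase x := Finset.mem_erase.2 ⟨fun h => hxy h.symm, hy⟩
        simp only [hx, hy, hx', hy', if_true]
        rw [fermiSign_erase (x := x) hy', fermiSign_erase (x := y) hx',
          Finset.erase_right_comm (a := x) (b := y)]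
        linear_combination (fermiSign x ((S.erase y).erase x) * fermiSign y ((S.erase y).erase x) *
          ψ ((S.erase y).erase x)) * swapSign_add hxy
      · have hy' : y ∉ S.erase x := fun h => hy (Finset.mem_of_mem_erase h)
        simp [hx, hy, hy']
    · have hx' : x ∉ S.erase y := fun h => hx (Finset.mem_of_mem_erase h)
      simp [hx, hx']

/-! ### Slater determinants -/

/-- The vacuum. -/
def vacuum (d L : ℕ) : Fock d L := EuclideanSpace.single ∅ 1

lemma annihilate_vacuum (x : Site d L) : annihilate x (vacuum d L) = 0 := by
  ext S
  rw [annihilate_apply]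
  simp [vacuum]

/-- The operator creating a particle with wave function `f`. -/
def createWave (f : Site d L → ℂ) : Fock d L →L[ℂ] Fock d L := ∑ x, f x • create x

/-- The operator annihilating a particle with wave function `g`. -/
def annihilateWave (g : Site d L → ℂ) : Fock d L →L[ℂ] Fock d L :=
  ∑ x, (starRingEnd ℂ) (g x) • annihilate x

/-- The inner product of wave functions. -/
def waveInner (g f : Site d L → ℂ) : ℂ := ∑ x, (starRingEnd ℂ) (g x) * f x

lemma createWave_apply (f : Site d L → ℂ) (ψ : Fock d L) (S : Finset (Site d L)) :
    createWave f ψ S = ∑ x ∈ S, f x * (fermiSign x (S.erase x) * ψ (S.erase x)) := by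
  simp [createWave, create_apply, Finset.sum_ite_mem]

lemma inner_createWave (g : Site d L → ℂ) (ψ φ : Fock d L) :
    inner ℂ (createWave g ψ) φ = inner ℂ ψ (annihilateWave g φ) := by
  simp [createWave, annihilateWave, create,
    ContinuousLinearMap.adjoint_inner_left, mul_comm]

lemma annihilate_createWave (y : Site d L) (f : Site d L → ℂ) (ψ : Fock d L) :
    annihilate y (createWave f ψ) = f y • ψ - createWave f (annihilate y ψ) := by
  simp [createWave, annihilate_create, smul_sub, Finset.sum_sub_distrib]

lemma create_createWave (y : Site d L) (f : Site d L → ℂ) (ψ : Fock d L) :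
    create y (createWave f ψ) = -createWave f (create y ψ) := by
  simp [createWave, create_create y, Finset.sum_neg_distrib]

lemma annihilateWave_createWave (g f : Site d L → ℂ) (ψ : Fock d L) :
    annihilateWave g (createWave f ψ) =
      waveInner g f • ψ - createWave f (annihilateWave g ψ) := by
  simp [annihilateWave, annihilate_createWave, smul_sub, Finset.sum_sub_distrib, waveInner,
    Finset.sum_smul, smul_smul]

/-- The state obtained by successively creating particles with wave functions `f i`. -/
def slater : (n : ℕ) → (Fin n → Site d L → ℂ) → Fock d L
  | 0, _ => vacuum d L
  | n + 1, f => createWave (f 0) (slater n fun i => f i.succ)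

/-- Moving the annihilator to the right past each creator changes the sign and leaves one
contraction, as in a Laplace expansion along a row; the vacuum kills the remainder. -/
lemma annihilateWave_slater (g : Site d L → ℂ) (n : ℕ) (f : Fin (n + 1) → Site d L → ℂ) :
    annihilateWave g (slater (n + 1) f) =
      ∑ j : Fin (n + 1), ((-1) ^ (j : ℕ) * waveInner g (f j)) • slater n fun i => f (j.succAbove i) := by
  induction n with
  | zero =>
    rw [slater, annihilateWave_createWave]
    have : annihilateWave g (vacuum d L) = 0 := by
      simp [annihilateWave, annihilate_vacuum]
    simp [slater, this]
  | succ n ih =>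
    rw [slater, annihilateWave_createWave, ih, map_sum, sub_eq_add_neg, ← Finset.sum_neg_distrib]
    conv_rhs => rw [Fin.sum_univ_succ]
    congr 1
    · simp
    · refine Finset.sum_congr rfl fun j _ => ?_
      rw [map_smul, ← neg_smul, Fin.val_succ, pow_succ, slater]
      simp only [Fin.succ_succAbove_zero, Fin.succ_succAbove_succ]
      congr 1
      ring

/-- The inner product of two Slater determinants. -/
lemma inner_slater (n : ℕ) (g f : Fin n → Site d L → ℂ) :
    inner ℂ (slater n g) (slater n f) =
      (Matrix.of fun i j => waveInner (g i) (f j)).det := by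
  induction n with
  | zero => simp [slater, vacuum]
  | succ n ih =>
    rw [slater, inner_createWave, annihilateWave_slater, inner_sum, Matrix.det_succ_row_zero]
    refine Finset.sum_congr rfl fun j _ => ?_
    rw [inner_smul_right, ih]
    rfl

lemma slater_apply_eq_zero (n : ℕ) (f : Fin n → Site d L → ℂ) (S : Finset (Site d L))
    (hS : S.card ≠ n) : slater n f S = 0 := by
  induction n generalizing S with
  | zero =>
    have : S ≠ ∅ := by simpa using hS
    simp [slater, vacuum, this]
  | succ n ih =>
    rw [slater, createWave_apply]
    refine Finset.sum_eq_zero fun x hx => ?_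
    rw [ih, mul_zero, mul_zero]
    rw [Finset.card_erase_of_mem hx]
    have := Finset.card_pos.2 ⟨x, hx⟩
    omega

/-- A weight on one-particle functions acts multiplicatively on configurations. Exponential moments
of `N_Γ` thus become norms of other Slater states. -/
lemma slater_mul_apply (w : Site d L → ℂ) (n : ℕ) (f : Fin n → Site d L → ℂ)
    (S : Finset (Site d L)) :
    slater n (fun i x => w x * f i x) S = (∏ x ∈ S, w x) * slater n f S := by
  induction n generalizing S with
  | zero =>
    by_cases hS : S = ∅
    · simp [slater, hS]
    · simp [slater, vacuum, hS]
  | succ n ih =>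
    rw [slater, slater, createWave_apply, createWave_apply, Finset.mul_sum]
    refine Finset.sum_congr rfl fun x hx => ?_
    rw [ih, ← Finset.mul_prod_erase S w hx]
    ring

/-- The second quantization of a one-particle operator with matrix `h`. -/
def secondQuantize (h : Site d L → Site d L → ℂ) : Fock d L →L[ℂ] Fock d L :=
  ∑ x, ∑ y, h x y • (create x ∘L annihilate y)

/-- Leibniz rule: a second quantized operator acts on one particle at a time, so energies of
eigenfunctions add up. -/
lemma secondQuantize_createWave (h : Site d L → Site d L → ℂ) (f : Site d L → ℂ) (ψ : Fock d L) :
    secondQuantize h (createWave f ψ) =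
      createWave (fun x => ∑ y, h x y * f y) ψ + createWave f (secondQuantize h ψ) := by
  simp only [secondQuantize, sum_apply, smul_apply, ContinuousLinearMap.comp_apply,
    annihilate_createWave, map_sub, map_smul, create_createWave, map_sum, sub_neg_eq_add, smul_add,
    Finset.sum_add_distrib]
  congr 1
  simp [createWave, Finset.sum_smul, smul_smul]

lemma secondQuantize_slater (h : Site d L → Site d L → ℂ) (n : ℕ) (f : Fin n → Site d L → ℂ)
    (ε : Fin n → ℂ) (hf : ∀ i x, ∑ y, h x y * f i y = ε i * f i x) :
    secondQuantize h (slater n f) = (∑ i, ε i) • slater n f := by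
  induction n with
  | zero => simp [slater, secondQuantize, annihilate_vacuum]
  | succ n ih =>
    rw [slater, secondQuantize_createWave, ih (fun i => f i.succ) (fun i => ε i.succ)
      fun i => hf i.succ, Fin.sum_univ_succ, add_smul, map_smul]
    congr 1
    simp only [hf, createWave, sum_apply, smul_apply, Finset.smul_sum, smul_smul]

end Fermions

section PlaneWaves

variable {d L : ℕ}

/-! ### Plane waves -/

/-- The matrix of the one-particle Hamiltonian. -/
def hopping (x y : Site d L) : ℂ := if torusDist x y = 1 then -1 else 0

lemma fockHamiltonian_eq_secondQuantize : fockHamiltonian d L = secondQuantize hopping := by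
  rw [fockHamiltonian, secondQuantize, ← Finset.sum_neg_distrib]
  refine Finset.sum_congr rfl fun x _ => ?_
  rw [← Finset.sum_neg_distrib, Finset.sum_filter]
  refine Finset.sum_congr rfl fun y _ => ?_
  rw [hopping]
  split_ifs
  · exact (neg_one_smul ℂ _).symm
  · exact (zero_smul ℂ _).symm

lemma torusDist_add_right [NeZero L] (x z : Site d L) : torusDist x (x + z) = torusDist 0 z := by
  unfold torusDist
  refine Finset.sum_congr rfl fun i _ => ?_
  simp

lemma torusDist_neg [NeZero L] (z : Site d L) : torusDist 0 (-z) = torusDist 0 z := by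
  unfold torusDist
  refine Finset.sum_congr rfl fun i _ => ?_
  simp [min_comm]

/-- There is an orthonormal basis of plane waves, which diagonalizes the one-particle
Hamiltonian. -/
lemma exists_planeWaves (d L : ℕ) [NeZero L] : ∃ (φ : Site d L → Site d L → ℂ) (ε : Site d L → ℝ),
    (∀ k k', waveInner (φ k) (φ k') = if k = k' then 1 else 0) ∧
    (∀ k x, (starRingEnd ℂ) (φ k x) * φ k x = (Fintype.card (Site d L) : ℂ)⁻¹) ∧
    ∀ k x, ∑ y, hopping x y * φ k y = ε k * φ k x := by
  classical
  set M : ℝ := (Fintype.card (Site d L) : ℝ) with hM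
  have hM0 : 0 < M := by
    rw [hM]
    exact_mod_cast Fintype.card_pos
  set s : ℂ := (((√M)⁻¹ : ℝ) : ℂ) with hs
  have hss : s * s = (M : ℂ)⁻¹ := by
    rw [hs, ← Complex.ofReal_mul, ← mul_inv, Real.mul_self_sqrt hM0.le, Complex.ofReal_inv]
  have hsc : (starRingEnd ℂ) s = s := by rw [hs, Complex.conj_ofReal]
  have hMC : (M : ℂ) = (Fintype.card (Site d L) : ℂ) := by rw [hM, Complex.ofReal_natCast]
  -- Plane waves are the characters of the finite abelian group of sites. There are as many of them
  -- as sites, and any labelling by sites serves.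
  let eqv : Site d L ≃ AddChar (Site d L) ℂ :=
    (Fintype.equivOfCardEq AddChar.card_eq).symm
  have hconj : ∀ (χ : AddChar (Site d L) ℂ) x, (starRingEnd ℂ) (χ x) = χ⁻¹ x := fun χ x => by
    rw [AddChar.inv_apply, AddChar.map_neg_eq_conj]
  -- Translation invariance makes each character an eigenfunction, with eigenvalue the Fourier
  -- transform of hopping from the origin; it is real because hopping is even.
  set E : Site d L → ℂ := fun k => ∑ z, hopping 0 z * eqv k z with hE
  have hreal : ∀ k, (((E k).re : ℝ) : ℂ) = E k := by
    intro k
    refine Complex.conj_eq_iff_re.1 ?_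
    rw [hE, map_sum, ← Equiv.sum_comp (Equiv.neg (Site d L))]
    refine Finset.sum_congr rfl fun z _ => ?_
    rw [map_mul, Equiv.neg_apply, AddChar.map_neg_eq_conj, Complex.conj_conj, hopping, hopping,
      torusDist_neg]
    split_ifs <;> simp
  refine ⟨fun k x => s * eqv k x, fun k => (E k).re, fun k k' => ?_, fun k x => ?_, fun k x => ?_⟩
  · have h1 : waveInner (fun x => s * eqv k x) (fun x => s * eqv k' x) =
        (M : ℂ)⁻¹ * ∑ x, ((eqv k)⁻¹ * eqv k') x := by
      rw [waveInner, Finset.mul_sum]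
      refine Finset.sum_congr rfl fun x _ => ?_
      rw [map_mul, hsc, hconj, AddChar.mul_apply, ← hss]
      ring
    rw [h1, AddChar.sum_eq_ite]
    by_cases hk : k = k'
    · subst hk
      rw [if_pos rfl, inv_mul_cancel, if_pos AddChar.one_eq_zero, ← hMC, inv_mul_cancel₀]
      exact_mod_cast hM0.ne'
    · rw [if_neg hk, if_neg, mul_zero]
      intro h
      exact hk (eqv.injective (inv_mul_eq_one.1 h))
  · rw [map_mul, hsc, ← hMC, ← hss]
    have h1 : (starRingEnd ℂ) (eqv k x) * eqv k x = 1 := by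
      rw [Complex.conj_mul', AddChar.norm_apply]
      simp
    linear_combination s * s * h1
  · dsimp only
    rw [hreal, hE, ← Equiv.sum_comp (Equiv.addLeft x), Finset.sum_mul]
    refine Finset.sum_congr rfl fun z _ => ?_
    rw [Equiv.coe_addLeft, AddChar.map_add_eq_mul, hopping, hopping, torusDist_add_right]
    ring

/-! ### The sector of `N` particles -/

/-- The component of a state in the `N`-particle sector. -/
def toSector (N : ℕ) (ψ : Fock d L) : NState d L N := WithLp.toLp 2 fun S => ψ S.1

lemma incl_toSector {N : ℕ} {ψ : Fock d L}
    (hψ : ∀ S : Finset (Site d L), S.card ≠ N → ψ S = 0) : incl d L N (toSector N ψ) = ψ := by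
  ext S
  rw [incl_apply]
  split_ifs with h
  · rfl
  · exact (hψ S h).symm

lemma sum_sector {M : Type*} [AddCommMonoid M] {N : ℕ} {g : Finset (Site d L) → M}
    (hg : ∀ S : Finset (Site d L), S.card ≠ N → g S = 0) :
    ∑ S : {S : Finset (Site d L) // S.card = N}, g S.1 = ∑ S, g S := by
  classical
  rw [← Finset.sum_subtype (Finset.univ.filter fun S : Finset (Site d L) => S.card = N)
    (by simp) g]
  refine Finset.sum_subset (Finset.filter_subset _ _) fun S _ hS => hg S ?_
  simpa using hS

lemma inner_toSector {N : ℕ} {ψ φ : Fock d L}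
    (hψ : ∀ S : Finset (Site d L), S.card ≠ N → ψ S = 0) :
    inner ℂ (toSector N ψ) (toSector N φ) = inner ℂ ψ φ := by
  rw [PiLp.inner_apply, PiLp.inner_apply]
  exact sum_sector (g := fun S => inner ℂ (ψ S) (φ S)) fun S hS => by rw [hψ S hS, inner_zero_left]

/-- The enumeration of the elements of a set of `N` sites. -/
def enum {N : ℕ} (K : {S : Finset (Site d L) // S.card = N}) (i : Fin N) : Site d L :=
  (K.1.equivFinOfCardEq K.2).symm i

lemma enum_mem {N : ℕ} (K : {S : Finset (Site d L) // S.card = N}) (i : Fin N) :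
    enum K i ∈ K.1 := Subtype.prop _

lemma enum_injective {N : ℕ} (K : {S : Finset (Site d L) // S.card = N}) :
    Function.Injective (enum K) :=
  Subtype.val_injective.comp (Equiv.injective _)

lemma exists_enum {N : ℕ} (K : {S : Finset (Site d L) // S.card = N}) {x : Site d L}
    (hx : x ∈ K.1) : ∃ i, enum K i = x :=
  ⟨K.1.equivFinOfCardEq K.2 ⟨x, hx⟩, by simp [enum]⟩

/-- The Slater determinant of the wave functions `φ k` with `k ∈ K`. -/
def sectorSlater {N : ℕ} (φ : Site d L → Site d L → ℂ)
    (K : {S : Finset (Site d L) // S.card = N}) : NState d L N :=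
  toSector N (slater N fun i => φ (enum K i))

/-- The Gram matrix is the identity for equal index sets. For distinct ones some `k ∈ K` is missing
from `K'` and gives a zero row. -/
lemma orthonormal_sectorSlater {N : ℕ} {φ : Site d L → Site d L → ℂ}
    (hφ : ∀ k k', waveInner (φ k) (φ k') = if k = k' then 1 else 0) :
    Orthonormal ℂ (sectorSlater (N := N) φ) := by
  classical
  rw [orthonormal_iff_ite]
  intro K K'
  rw [sectorSlater, sectorSlater, inner_toSector (slater_apply_eq_zero N _), inner_slater]
  simp only [hφ]
  split_ifs with hK
  · subst hK
    convert! Matrix.det_one (n := Fin N) (R := ℂ) using 2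
    ext i j
    simp [Matrix.one_apply, (enum_injective K).eq_iff]
  · obtain ⟨x, hx, hx'⟩ : ∃ x ∈ K.1, x ∉ K'.1 := by
      by_contra! hsub
      exact hK (Subtype.ext (Finset.eq_of_subset_of_card_le hsub (by rw [K.2, K'.2])))
    obtain ⟨i, rfl⟩ := exists_enum K hx
    refine Matrix.det_eq_zero_of_row_eq_zero i fun j => ?_
    rw [Matrix.of_apply, if_neg]
    exact fun h => hx' (h ▸ enum_mem K' j)

lemma freeHamiltonian_sectorSlater {N : ℕ} {φ : Site d L → Site d L → ℂ} {ε : Site d L → ℝ}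
    (hε : ∀ k x, ∑ y, hopping x y * φ k y = ε k * φ k x)
    (K : {S : Finset (Site d L) // S.card = N}) :
    freeHamiltonian d L N (sectorSlater φ K) =
      ((∑ i, ε (enum K i) : ℝ) : ℂ) • sectorSlater φ K := by
  ext S
  change fockHamiltonian d L (incl d L N (sectorSlater φ K)) S.1 = _
  rw [sectorSlater, incl_toSector (slater_apply_eq_zero N _), fockHamiltonian_eq_secondQuantize,
    secondQuantize_slater hopping N _ (fun i => (ε (enum K i) : ℂ)) fun i => hε _]
  rw [Complex.ofReal_sum]
  rfl

end PlaneWaves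

section Tail

open scoped ComplexOrder

variable {d L : ℕ}

/-! ### The number operator -/

/-- The number of particles of a configuration in the region `Γ`. -/
def countIn (Γ S : Finset (Site d L)) : ℝ := ∑ x ∈ S, if x ∈ Γ then 1 else 0

lemma create_annihilate_self (x : Site d L) (ψ : Fock d L) (S : Finset (Site d L)) :
    create x (annihilate x ψ) S = if x ∈ S then ψ S else 0 := by
  rw [create_apply, annihilate_apply]
  split_ifs with h1 h2
  · exact absurd h2 (Finset.notMem_erase x S)
  · rw [Finset.insert_erase h1, ← mul_assoc, fermiSign_mul_self, one_mul]
  · rfl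

lemma numberOp_apply {N : ℕ} (Γ : Finset (Site d L)) (ψ : NState d L N)
    (S : {S : Finset (Site d L) // S.card = N}) :
    numberOp N Γ ψ S = (countIn Γ S.1 : ℂ) * ψ S := by
  change fockNumber Γ (incl d L N ψ) S.1 = _
  have h1 : incl d L N ψ S.1 = ψ S := by rw [incl_apply, dif_pos S.2]
  rw [fockNumber, sum_apply, WithLp.ofLp_sum, Finset.sum_apply, countIn]
  simp only [ContinuousLinearMap.comp_apply, create_annihilate_self, h1]
  rw [Finset.sum_ite_mem, ← Finset.sum_filter, Finset.filter_mem_eq_inter, Finset.inter_comm]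
  simp

lemma eqProj_apply {N : ℕ} (Γ : Finset (Site d L)) (η : ℝ) (ψ : NState d L N)
    (S : {S : Finset (Site d L) // S.card = N}) [Decidable (countIn Γ S.1 ∈
      Icc (N * (relSize Γ - η)) (N * (relSize Γ + η)))] :
    eqProj N Γ η ψ S = if countIn Γ S.1 ∈ Icc (N * (relSize Γ - η)) (N * (relSize Γ + η))
      then ψ S else 0 := by
  classical
  set I : Set ℝ := Icc (N * (relSize Γ - η)) (N * (relSize Γ + η)) with hI
  set v : NState d L N := WithLp.toLp 2 fun S => if countIn Γ S.1 ∈ I then ψ S else 0 with hv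
  suffices h : eqProj N Γ η ψ = v by
    rw [h, hv]
    dsimp only
    congr
  rw [eqProj, spectralProj]
  refine Submodule.eq_starProjection_of_mem_orthogonal ?_ ?_
  · have hsum : v = ∑ T, v T • EuclideanSpace.single T (1 : ℂ) := by
      ext S
      simp [WithLp.ofLp_sum, Finset.sum_apply, Pi.single_apply]
    rw [hsum]
    refine Submodule.sum_mem _ fun T _ => ?_
    by_cases hT : countIn Γ T.1 ∈ I
    · refine Submodule.smul_mem _ _ (Submodule.mem_iSup_of_mem (countIn Γ T.1)
        (Submodule.mem_iSup_of_mem hT (mem_eigenspace_iff.2 ?_)))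
      ext S
      rw [numberOp_apply]
      by_cases hS : S = T
      · subst hS; simp
      · simp [hS]
    · have : v T = 0 := by simp [hv, hT]
      rw [this, zero_smul]
      exact Submodule.zero_mem _
  -- Orthogonality holds because every vector in the spectral subspace vanishes at configurations
  -- whose count lies outside the interval, and `ψ - v` vanishes at the others.
  · intro w hw
    have hle : (⨆ r ∈ I, Module.End.eigenspace
        (numberOp N Γ : NState d L N →ₗ[ℂ] NState d L N) (r : ℂ)) ≤
        { carrier := {w : NState d L N | ∀ T, countIn Γ T.1 ∉ I → w T = 0}
          add_mem' := fun {a b} ha hb T hT => by simp [ha T hT, hb T hT]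
          zero_mem' := fun T _ => rfl
          smul_mem' := fun c a ha T hT => by simp [ha T hT] } := by
      refine iSup₂_le fun r hr w hw T hT => ?_
      have h1 := congrArg (fun ψ : NState d L N => ψ T) (mem_eigenspace_iff.1 hw)
      dsimp only at h1
      rw [numberOp_apply, PiLp.smul_apply, smul_eq_mul, ← sub_eq_zero, ← sub_mul] at h1
      refine (mul_eq_zero.1 h1).resolve_left fun h2 => hT ?_
      have h3 : countIn Γ T.1 = r := by exact_mod_cast sub_eq_zero.1 h2
      rwa [h3]
    have hw' := hle hw
    rw [PiLp.inner_apply]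
    refine Finset.sum_eq_zero fun T _ => ?_
    by_cases hT : countIn Γ T.1 ∈ I
    · simp [hv, hT]
    · rw [hw' T hT, inner_zero_left]

lemma norm_sq_neqProj {N : ℕ} (Γ : Finset (Site d L)) (η : ℝ) (ψ : NState d L N)
    [DecidablePred fun S : {S : Finset (Site d L) // S.card = N} => countIn Γ S.1 ∈
      Icc (N * (relSize Γ - η)) (N * (relSize Γ + η))] :
    ‖neqProj N Γ η ψ‖ ^ 2 = ∑ S : {S : Finset (Site d L) // S.card = N},
      if countIn Γ S.1 ∈ Icc (N * (relSize Γ - η)) (N * (relSize Γ + η)) then 0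
        else ‖ψ S‖ ^ 2 := by
  rw [EuclideanSpace.norm_sq_eq]
  refine Finset.sum_congr rfl fun S _ => ?_
  rw [neqProj, sub_apply, PiLp.sub_apply, eqProj_apply]
  split_ifs <;> simp

/-! ### Exponential moments -/

/-- A determinant bound for positive semidefinite matrices in terms of the trace. -/
lemma det_re_le_pow {n : ℕ} {A : Matrix (Fin n) (Fin n) ℂ} (hA : A.PosSemidef) {c : ℝ} (hc : 0 < c)
    (htr : A.trace = (n * c : ℝ)) : A.det.re ≤ c ^ n := by
  have h1 : ∑ i, hA.1.eigenvalues i = n * c := by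
    have := hA.1.trace_eq_sum_eigenvalues
    rw [htr] at this
    refine Complex.ofReal_injective ?_
    rw [Complex.ofReal_sum]
    exact this.symm
  have h2 : A.det.re = ∏ i, hA.1.eigenvalues i := by
    rw [hA.1.det_eq_prod_eigenvalues]
    norm_cast
  rw [h2]
  -- Each eigenvalue `x` satisfies `x ≤ c exp(x / c - 1)`; the trace condition makes the exponents
  -- sum to zero.
  calc ∏ i, hA.1.eigenvalues i ≤ ∏ i : Fin n, c * Real.exp (hA.1.eigenvalues i / c - 1) := by
        refine Finset.prod_le_prod (fun i _ => hA.eigenvalues_nonneg i) fun i _ => ?_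
        have h3 := Real.add_one_le_exp (hA.1.eigenvalues i / c - 1)
        rw [sub_add_cancel, div_le_iff₀ hc] at h3
        linarith
    _ = c ^ n := by
        rw [Finset.prod_mul_distrib, ← Real.exp_sum, Finset.sum_sub_distrib, ← Finset.sum_div, h1]
        simp [hc.ne']

lemma exp_le_quadratic {y : ℝ} (hy : |y| ≤ 1) : Real.exp y ≤ 1 + y + 3 / 4 * y ^ 2 := by
  have h := (abs_le.1 (Real.exp_bound hy (n := 2) (by norm_num))).2
  simp [Finset.sum_range_succ, Nat.factorial] at h
  linarith

/-- The exponential moment of a centered Bernoulli variable. -/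
lemma bernoulli_exp_moment {m t : ℝ} (h0 : 0 ≤ m) (h1 : m ≤ 1) (ht : |t| ≤ 1) :
    (1 + (Real.exp t - 1) * m) * Real.exp (-(t * m)) ≤
      Real.exp (3 / 4 * t ^ 2 * (m * (1 - m))) := by
  have ha : Real.exp (-(t * m)) ≤ 1 + -(t * m) + 3 / 4 * (-(t * m)) ^ 2 := by
    refine exp_le_quadratic ?_
    rw [abs_neg, abs_mul, abs_of_nonneg h0]
    nlinarith [abs_nonneg t]
  have hb : Real.exp (t * (1 - m)) ≤ 1 + t * (1 - m) + 3 / 4 * (t * (1 - m)) ^ 2 := by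
    refine exp_le_quadratic ?_
    rw [abs_mul, abs_of_nonneg (by linarith : 0 ≤ 1 - m)]
    nlinarith [abs_nonneg t]
  have hab : Real.exp t * Real.exp (-(t * m)) = Real.exp (t * (1 - m)) := by
    rw [← Real.exp_add]
    ring_nf
  calc (1 + (Real.exp t - 1) * m) * Real.exp (-(t * m))
      = (1 - m) * Real.exp (-(t * m)) + m * (Real.exp t * Real.exp (-(t * m))) := by ring
    _ ≤ (1 - m) * (1 + -(t * m) + 3 / 4 * (-(t * m)) ^ 2) +
        m * (1 + t * (1 - m) + 3 / 4 * (t * (1 - m)) ^ 2) := by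
        rw [hab]
        exact add_le_add (mul_le_mul_of_nonneg_left ha (by linarith))
          (mul_le_mul_of_nonneg_left hb h0)
    _ = 3 / 4 * t ^ 2 * (m * (1 - m)) + 1 := by ring
    _ ≤ _ := Real.add_one_le_exp _

lemma sum_indicator (Γ : Finset (Site d L)) (t : ℝ) :
    ∑ x : Site d L, Real.exp (t * if x ∈ Γ then 1 else 0) =
      Fintype.card (Site d L) + (Real.exp t - 1) * Γ.card := by
  have : ∀ x : Site d L, Real.exp (t * if x ∈ Γ then 1 else 0) =
      1 + if x ∈ Γ then Real.exp t - 1 else 0 := fun x => by split_ifs <;> simp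
  simp_rw [this]
  rw [Finset.sum_add_distrib, Finset.sum_ite_mem]
  simp
  ring

lemma relSize_mem [NeZero L] (Γ : Finset (Site d L)) : 0 ≤ relSize Γ ∧ relSize Γ ≤ 1 := by
  have hM : (0 : ℝ) < Fintype.card (Site d L) := by exact_mod_cast Fintype.card_pos
  refine ⟨by unfold relSize; positivity, ?_⟩
  rw [relSize, div_le_one hM]
  exact_mod_cast Finset.card_le_univ Γ

/-- Exponential moments of the particle number in a Slater determinant of plane waves. -/
lemma exp_moment_sectorSlater [NeZero L] {N : ℕ} {φ : Site d L → Site d L → ℂ}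
    (hφ : ∀ k x, (starRingEnd ℂ) (φ k x) * φ k x = (Fintype.card (Site d L) : ℂ)⁻¹)
    (Γ : Finset (Site d L)) (K : {S : Finset (Site d L) // S.card = N}) (t : ℝ) :
    ∑ S, Real.exp (t * countIn Γ S.1) * ‖sectorSlater φ K S‖ ^ 2 ≤
      (1 + (Real.exp t - 1) * relSize Γ) ^ N := by
  have hM : (0 : ℝ) < Fintype.card (Site d L) := by exact_mod_cast Fintype.card_pos
  -- Half of `t`, because the weight is squared in the norm.
  set w : Site d L → ℝ := fun x => Real.exp (t / 2 * if x ∈ Γ then 1 else 0) with hw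
  set f : Fin N → Site d L → ℂ := fun i x => (w x : ℂ) * φ (enum K i) x with hf
  set B : Matrix (Site d L) (Fin N) ℂ := Matrix.of fun x i => f i x with hB
  have hgram : (Matrix.of fun i j => waveInner (f i) (f j)) = B.conjTranspose * B := by
    ext i j
    rw [Matrix.mul_apply]
    rfl
  have hw2 : ∀ x, w x * w x = Real.exp (t * if x ∈ Γ then 1 else 0) := fun x => by
    rw [hw, ← Real.exp_add]
    ring_nf
  have h1 : ∑ S : {S : Finset (Site d L) // S.card = N},
      Real.exp (t * countIn Γ S.1) * ‖sectorSlater φ K S‖ ^ 2 = ‖toSector N (slater N f)‖ ^ 2 := by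
    rw [EuclideanSpace.norm_sq_eq]
    refine Finset.sum_congr rfl fun S _ => ?_
    change _ * ‖slater N (fun i => φ (enum K i)) S.1‖ ^ 2 = ‖slater N f S.1‖ ^ 2
    rw [hf, slater_mul_apply, norm_mul, mul_pow, ← Complex.ofReal_prod, Complex.norm_real,
      Real.norm_eq_abs, sq_abs, ← Finset.prod_pow, countIn, Finset.mul_sum, Real.exp_sum]
    congr 1
    exact Finset.prod_congr rfl fun x _ => by rw [sq, hw2]
  have h2 : ‖toSector N (slater N f)‖ ^ 2 = (B.conjTranspose * B).det.re := by
    have h3 : inner ℂ (toSector N (slater N f)) (toSector N (slater N f)) =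
        (B.conjTranspose * B).det := by
      rw [inner_toSector (slater_apply_eq_zero N _), inner_slater, hgram]
    rw [← h3, inner_self_eq_norm_sq_to_K]
    norm_cast
  rw [h1, h2]
  refine det_re_le_pow (Matrix.posSemidef_conjTranspose_mul_self B) ?_ ?_
  · obtain ⟨h0, h1⟩ := relSize_mem Γ
    have h2 := mul_nonneg (Real.exp_pos t).le h0
    rcases h1.lt_or_eq with h3 | h3
    · linarith
    · rw [h3]
      linarith [Real.exp_pos t]
  · have hdiag : ∀ i, waveInner (f i) (f i) = ((1 + (Real.exp t - 1) * relSize Γ : ℝ) : ℂ) := by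
      intro i
      have h4 : ∀ x, (starRingEnd ℂ) (f i x) * f i x =
          ((Real.exp (t * if x ∈ Γ then 1 else 0) * (Fintype.card (Site d L) : ℝ)⁻¹ : ℝ) : ℂ) := by
        intro x
        rw [← hw2, hf]
        simp only [map_mul, Complex.conj_ofReal]
        push_cast
        rw [← hφ (enum K i) x]
        ring
      rw [waveInner, Finset.sum_congr rfl fun x _ => h4 x, ← Complex.ofReal_sum, ← Finset.sum_mul,
        sum_indicator]
      congr 1
      rw [relSize]
      field_simp
    rw [← hgram, Matrix.trace]
    simp only [Matrix.diag_apply, Matrix.of_apply, hdiag, Finset.sum_const, Finset.card_univ,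
      Fintype.card_fin, nsmul_eq_mul]
    push_cast
    ring

/-- A Chernoff bound for the particle number in a Slater determinant of plane waves. -/
lemma tail_sectorSlater [NeZero L] {N : ℕ} {φ : Site d L → Site d L → ℂ}
    (hφ : ∀ k x, (starRingEnd ℂ) (φ k x) * φ k x = (Fintype.card (Site d L) : ℂ)⁻¹)
    (Γ : Finset (Site d L)) (K : {S : Finset (Site d L) // S.card = N}) {t : ℝ} (ht : |t| ≤ 1)
    (b : ℝ) (p : {S : Finset (Site d L) // S.card = N} → Prop) [DecidablePred p]
    (hp : ∀ S, p S → N * b ≤ t * (countIn Γ S.1 - N * relSize Γ)) :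
    ∑ S, (if p S then ‖sectorSlater φ K S‖ ^ 2 else 0) ≤
      Real.exp (N * (3 / 4 * t ^ 2 * (relSize Γ * (1 - relSize Γ)) - b)) := by
  obtain ⟨h0, h1⟩ := relSize_mem Γ
  calc ∑ S, (if p S then ‖sectorSlater φ K S‖ ^ 2 else 0)
      ≤ ∑ S, Real.exp (-(N * (t * relSize Γ + b))) *
        (Real.exp (t * countIn Γ S.1) * ‖sectorSlater φ K S‖ ^ 2) := by
        refine Finset.sum_le_sum fun S _ => ?_
        split_ifs with hS
        · rw [← mul_assoc, ← Real.exp_add]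
          refine le_mul_of_one_le_left (by positivity) (Real.one_le_exp ?_)
          linarith [hp S hS]
        · positivity
    _ ≤ Real.exp (-(N * (t * relSize Γ + b))) * (1 + (Real.exp t - 1) * relSize Γ) ^ N := by
        rw [← Finset.mul_sum]
        exact mul_le_mul_of_nonneg_left (exp_moment_sectorSlater hφ Γ K t) (Real.exp_pos _).le
    _ = Real.exp (-(N * b)) *
        ((1 + (Real.exp t - 1) * relSize Γ) * Real.exp (-(t * relSize Γ))) ^ N := by
        rw [mul_pow, ← Real.exp_nat_mul, mul_comm (_ ^ N), ← mul_assoc, ← Real.exp_add]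
        ring_nf
    _ ≤ Real.exp (-(N * b)) * Real.exp (3 / 4 * t ^ 2 * (relSize Γ * (1 - relSize Γ))) ^ N := by
        gcongr
        · have : 0 ≤ 1 + (Real.exp t - 1) * relSize Γ := by nlinarith [Real.exp_pos t]
          positivity
        · exact bernoulli_exp_moment h0 h1 ht
    _ = _ := by
        rw [← Real.exp_nat_mul, ← Real.exp_add]
        ring_nf

/-- In a Slater determinant of plane waves, the particle number in `Γ` is concentrated around its
mean. -/
theorem norm_sq_neqProj_sectorSlater_le [NeZero L] {N : ℕ} {φ : Site d L → Site d L → ℂ}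
    (hφ : ∀ k x, (starRingEnd ℂ) (φ k x) * φ k x = (Fintype.card (Site d L) : ℂ)⁻¹)
    (Γ : Finset (Site d L)) {η : ℝ} (hη : 0 < η)
    (hη' : η < 3 / 2 * (relSize Γ * (1 - relSize Γ)))
    (K : {S : Finset (Site d L) // S.card = N}) :
    ‖neqProj N Γ η (sectorSlater φ K)‖ ^ 2 ≤
      2 * Real.exp (-(η ^ 2 / (3 * relSize Γ * (1 - relSize Γ)) * N)) := by
  classical
  set v : ℝ := relSize Γ * (1 - relSize Γ) with hv
  have hv0 : 0 < v := by linarith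
  -- The minimizer of `3/4 t² v - t η`, with minimum `-η² / (3v)`. The upper bound on `η` is what
  -- gives `t ≤ 1`, the range of the quadratic bound on the exponential; `t` and `-t` treat the two
  -- tails.
  set t : ℝ := 2 * η / (3 * v) with ht
  have ht0 : 0 < t := by positivity
  have ht1 : t ≤ 1 := by
    rw [ht, div_le_one (by positivity)]
    linarith
  have hexp : ∀ s : ℝ, s ^ 2 = t ^ 2 → Real.exp (N * (3 / 4 * s ^ 2 * v - t * η)) =
      Real.exp (-(η ^ 2 / (3 * relSize Γ * (1 - relSize Γ)) * N)) := by
    intro s hs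
    rw [hs, mul_assoc 3, ← hv, ht]
    congr 1
    field_simp
    ring
  have hN : (0 : ℝ) ≤ N := Nat.cast_nonneg N
  have hupper := tail_sectorSlater hφ Γ K (t := t) (by rwa [abs_of_pos ht0]) (t * η)
    (fun S => N * (relSize Γ + η) < countIn Γ S.1) (fun S hS => by nlinarith)
  have hlower := tail_sectorSlater hφ Γ K (t := -t) (by rwa [abs_neg, abs_of_pos ht0]) (t * η)
    (fun S => countIn Γ S.1 < N * (relSize Γ - η)) (fun S hS => by nlinarith)
  rw [← hv, hexp _ rfl] at hupper
  rw [← hv, hexp _ (neg_sq t)] at hlower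
  rw [norm_sq_neqProj, two_mul]
  refine le_trans ?_ (add_le_add hupper hlower)
  rw [← Finset.sum_add_distrib]
  refine Finset.sum_le_sum fun S _ => ?_
  by_cases h1 : N * (relSize Γ + η) < countIn Γ S.1
  · rw [if_pos h1]
    split_ifs <;> first | positivity | simp
  · by_cases h2 : countIn Γ S.1 < N * (relSize Γ - η)
    · rw [if_neg h1, if_pos h2]
      split_ifs <;> first | positivity | simp
    · rw [if_pos ⟨not_lt.1 h2, not_lt.1 h1⟩, if_neg h1, if_neg h2, add_zero]

end Tail

end

end FermiGas

/-! ### Thermalization of the free Fermi gas. -/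

theorem mainTheorem6 (d L N : ℕ) (hd : 1 ≤ d) (Γ : Finset (FermiGas.Site d L)) (η : ℝ)
    (hη : 0 < η) (hη' : η < 3 / 2 * (FermiGas.relSize Γ * (1 - FermiGas.relSize Γ)))
    (ρ : Measure (selfAdjoint (FermiGas.NState d L N →L[ℂ] FermiGas.NState d L N)))
    [IsProbabilityMeasure ρ] (hρc : FermiGas.IsContinuousLaw ρ)
    (hρi : FermiGas.IsInvariantLaw (FermiGas.freeHamiltonian d L N) ρ)
    (Hν : Submodule ℂ (FermiGas.NState d L N)) (hHν : Hν ≠ ⊥) :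
    ∀ δ δ' δ'' : ℝ, 0 < δ → 0 < δ' → 0 < δ'' →
      ∃ lam₀ : ℝ, 0 < lam₀ ∧ ∀ lam ∈ Ioo 0 lam₀,
        FermiGas.ForMost ρ δ fun V =>
          FermiGas.ForMost (FermiGas.uniformSphere Hν) δ' fun ψ₀ =>
            FermiGas.ForMostTimes δ'' fun t =>
              ‖FermiGas.neqProj N Γ η
                (FermiGas.evolve
                  (FermiGas.freeHamiltonian d L N +
                    (lam : ℂ) • (V : FermiGas.NState d L N →L[ℂ] FermiGas.NState d L N))
                  t (ψ₀.1 : FermiGas.NState d L N))‖ ^ 2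
              < 6 / (δ * δ' * δ'') *
                Real.exp (-(η ^ 2 / (3 * FermiGas.relSize Γ * (1 - FermiGas.relSize Γ)) * N)) := by
  intro δ δ' δ'' hδ hδ' hδ''
  -- For `L = 0` and `d ≥ 1` the lattice is empty and `relSize Γ` takes the default value `0 / 0 =
  -- 0`, contradicting `0 < η < 0`.
  have : NeZero L := by
    refine ⟨fun hL => ?_⟩
    subst hL
    have : IsEmpty (FermiGas.Site d 0) := ⟨fun x => (x ⟨0, hd⟩).elim0⟩
    have h0 : FermiGas.relSize Γ = 0 := by simp [FermiGas.relSize]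
    rw [h0] at hη'
    linarith
  obtain ⟨φ, ε, hφ, hφ', hε⟩ := FermiGas.exists_planeWaves d L
  obtain ⟨Ψ, hΨ⟩ := FermiGas.exists_orthonormalBasis_of_card
    (FermiGas.orthonormal_sectorSlater (N := N) hφ) (by simp)
  have hbasis : FermiGas.IsEigenbasis (FermiGas.freeHamiltonian d L N) Ψ
      fun K => ∑ i, ε (FermiGas.enum K i) := by
    intro K
    rw [hΨ]
    exact FermiGas.freeHamiltonian_sectorSlater hε K
  -- Here `ε` is twice the exponential, one for each tail, so the constant is `3 * 2 = 6`.
  obtain ⟨lam₀, h0, h⟩ := hbasis.thermalization hρc hρi hHν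
    (mul_pos two_pos (Real.exp_pos
      (-(η ^ 2 / (3 * FermiGas.relSize Γ * (1 - FermiGas.relSize Γ)) * N))))
    (fun K => by
      rw [hΨ]
      exact FermiGas.norm_sq_neqProj_sectorSlater_le hφ' Γ hη hη' K) hδ hδ' hδ''
  refine ⟨lam₀, h0, fun lam hlam => ?_⟩
  convert! h lam hlam using 7
  ring
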